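/- For an irreducible complex character $\chi$ of a finite group $G$, let $\ker\chi=\{g\in G:\chi(g)=\chi(1)\}$ and call $|G:\ker\chi|/\chi(1)$ the codegree of $\chi$. Let $\mathrm{cd}(G)=\{\chi(1)\}$ and $\mathrm{cod}(G)=\{|G:\ker\chi|/\chi(1)\}$, where $\chi$ runs over the irreducible complex characters of $G$. A group of order $p^n$ with $n\ge 2$ has maximal class if its nilpotency class is $n-1$. Let $p$ be a prime, $n\ge 2$ an integer, and $G$ a group of order $p^n$. Then $\mathrm{cod}(G)=\{p^i : 0\le i\le n-1\}$ if and only if one of the following occurs: (1) $G\cong \mathbb{Z}_{p^{n-1}}\times\mathbb{Z}_p$; (2) $G\cong \mathbb{Z}_{p^{n-1}}\rtimes\mathbb{Z}_p$ (for some action of $\mathbb{Z}_p$ on $\mathbb{Z}_{p^{n-1}}$ by automorphisms), $G$ has nilpotency class $2$, and $n\ge 4$; (3) $G$ has maximal class and $|\mathrm{cd}(G)|=2$. Moreover, if $\mathrm{cod}(G)=\{p^i : 0\le i\le n-1\}$, then $G$ has nilpotency class at most $2$ or $G$ has maximal class. -/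

import Mathlib

namespace FiniteGroupCharacters

/-- A linear endomorphism of finite order of a finite-dimensional complex vector space whose trace
equals the dimension is the identity. -/
theorem eq_one_of_trace_eq_finrank {V : Type} [AddCommGroup V] [Module ℂ V]
    [FiniteDimensional ℂ V] (f : Module.End ℂ V) (m : ℕ) (hm : 0 < m) (hf : f ^ m = 1)
    (ht : LinearMap.trace ℂ V f = (Module.finrank ℂ V : ℂ)) : f = 1 := by
  have hroot : ∀ z ∈ f.charpoly.roots, ‖z‖ = 1 := by
    intro z hz
    have hz' : f.HasEigenvalue z := by
      rw [Module.End.hasEigenvalue_iff_isRoot_charpoly]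
      exact (Polynomial.mem_roots'.1 hz).2
    obtain ⟨v, hv⟩ := hz'.exists_hasEigenvector
    have h1 := hv.pow_apply m
    rw [hf, Module.End.one_apply] at h1
    have h2 : z ^ m = 1 := by
      have : (z ^ m - 1) • v = 0 := by rw [sub_smul, one_smul, ← h1, sub_self]
      rcases smul_eq_zero.1 this with h | h
      · exact sub_eq_zero.1 h
      · exact absurd h hv.2
    exact Complex.norm_eq_one_of_pow_eq_one h2 hm.ne'
  have hsplit : f.charpoly.Splits := IsAlgClosed.splits _
  have hcard : f.charpoly.roots.card = Module.finrank ℂ V := by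
    rw [← hsplit.natDegree_eq_card_roots, LinearMap.charpoly_natDegree]
  have hsum : f.charpoly.roots.sum = (f.charpoly.roots.card : ℂ) := by
    rw [hcard, ← ht, Module.End.trace_eq_sum_roots_charpoly_of_splits hsplit]
  have key : ∀ s : Multiset ℂ, (∀ z ∈ s, ‖z‖ = 1) →
      s.sum.re ≤ s.card ∧ (s.sum.re = s.card → ∀ z ∈ s, z = 1) := by
    intro s
    induction s using Multiset.induction_on with
    | empty => intro _; simp
    | cons a s ih =>
      intro h
      obtain ⟨h1, h2⟩ := ih (fun z hz => h z (Multiset.mem_cons_of_mem hz))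
      have ha : ‖a‖ = 1 := h a (Multiset.mem_cons_self a s)
      have hre : a.re ≤ 1 := ha ▸ Complex.re_le_norm a
      simp only [Multiset.sum_cons, Complex.add_re, Multiset.card_cons, Nat.cast_add,
        Nat.cast_one]
      refine ⟨by linarith, fun he z hz => ?_⟩
      have hre1 : a.re = 1 := by linarith
      rcases Multiset.mem_cons.1 hz with rfl | hz
      · have hn := Complex.sq_norm z
        rw [Complex.normSq_apply, ha, hre1] at hn
        have : z.im = 0 := by nlinarith
        exact Complex.ext (by simpa using hre1) (by simpa using this)
      · exact h2 (by linarith) z hz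
  have hone : ∀ z ∈ f.charpoly.roots, z = 1 := (key _ hroot).2 (by rw [hsum]; simp)
  have hss : f.IsSemisimple := by
    refine Module.End.isSemisimple_of_squarefree_aeval_eq_zero
      (p := Polynomial.X ^ m - 1) ?_ (by simp [hf])
    have : (Polynomial.X ^ m - Polynomial.C (1 : ℂ)).Separable :=
      Polynomial.separable_X_pow_sub_C 1 (by exact_mod_cast hm.ne') one_ne_zero
    simpa using this.squarefree
  have hpoly : f.charpoly = (Polynomial.X - Polynomial.C 1) ^ f.charpoly.roots.card := by
    conv_lhs => rw [hsplit.eq_prod_roots_of_monic f.charpoly_monic]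
    rw [Multiset.eq_replicate_card.2 hone]
    simp
  have hnil : IsNilpotent (f - 1) := by
    refine ⟨f.charpoly.roots.card, ?_⟩
    have h := f.aeval_self_charpoly
    rw [hpoly] at h
    simpa using h
  have hss' : (f - 1).IsSemisimple := by
    have := hss.sub_of_commute (Commute.one_right f) Module.End.isSemisimple_id
    exact this
  exact sub_eq_zero.1 (Module.End.eq_zero_of_isNilpotent_isSemisimple hnil hss')

/-- `χ` is the character of an irreducible complex representation of `G`. -/
def IsIrrChar {G : Type*} [Group G] (χ : G → ℂ) : Prop :=
  ∃ (V : Type) (_ : AddCommGroup V) (_ : Module ℂ V) (_ : FiniteDimensional ℂ V)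
    (ρ : Representation ℂ G V), ρ.IsIrreducible ∧ χ = ρ.character

/-- The set `Irr(G)` of irreducible complex characters of `G`. -/
abbrev Irr (G : Type*) [Group G] : Set (G → ℂ) := {χ | IsIrrChar χ}

/-- The kernel of a representation consists of the points where its character takes the same
value as at the identity. -/
theorem mem_ker_iff {G : Type*} [Group G] [Finite G] {V : Type} [AddCommGroup V] [Module ℂ V]
    [FiniteDimensional ℂ V] (ρ : Representation ℂ G V) (g : G) :
    g ∈ MonoidHom.ker ρ ↔ ρ.character g = ρ.character 1 := by
  rw [MonoidHom.mem_ker]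
  refine ⟨fun h => by simp [Representation.character, h], fun h => ?_⟩
  refine eq_one_of_trace_eq_finrank (ρ g) (orderOf g) (orderOf_pos g) ?_ ?_
  · rw [← map_pow, pow_orderOf_eq_one, map_one]
  · rw [Representation.char_one] at h
    exact h

/-- The kernel `{g | χ(g) = χ(1)}` of an irreducible character of a finite group. -/
def ker {G : Type*} [Group G] [Finite G] (χ : Irr G) : Subgroup G where
  carrier := {g | χ.1 g = χ.1 1}
  one_mem' := rfl
  mul_mem' := by
    obtain ⟨χ, V, _, _, _, ρ, -, rfl⟩ := χ
    intro a b ha hb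
    exact (mem_ker_iff ρ _).1 (mul_mem ((mem_ker_iff ρ a).2 ha) ((mem_ker_iff ρ b).2 hb))
  inv_mem' := by
    obtain ⟨χ, V, _, _, _, ρ, -, rfl⟩ := χ
    intro a ha
    exact (mem_ker_iff ρ _).1 (inv_mem ((mem_ker_iff ρ a).2 ha))

/-- The codegree `|G : ker χ| / χ(1)` of an irreducible character of a finite group. -/
noncomputable def codegree {G : Type*} [Group G] [Finite G] (χ : Irr G) : ℂ :=
  ((ker χ).index : ℂ) / χ.1 1

/-- The set `cd(G)` of degrees of the irreducible characters of `G`. -/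
def cd (G : Type*) [Group G] : Set ℂ := {d | ∃ χ : Irr G, d = χ.1 1}

/-- The set `cod(G)` of codegrees of the irreducible characters of `G`. -/
def cod (G : Type*) [Group G] [Finite G] : Set ℂ := {c | ∃ χ : Irr G, c = codegree χ}

/-- `G` has order `p ^ n` for some `n ≥ 2`, and nilpotency class `n - 1`, the largest possible. -/
def HasMaximalClass (p : ℕ) (G : Type*) [Group G] : Prop :=
  ∃ n : ℕ, 2 ≤ n ∧ Nat.card G = p ^ n ∧ Group.nilpotencyClass G = n - 1

end FiniteGroupCharacters

/-! ### Irreducible representations recorded by kernel and dimension -/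

namespace FiniteGroupCharacters

open Module

universe u

/-! Necessity starts from a character $\chi$ of codegree $p^{n-1}$. If $\chi$ is linear, its kernel
has order $p$, hence is central, and the quotient is cyclic, so $G$ is abelian; it is not cyclic,
because $p^n$ is not a codegree, and it splits as in (1). Otherwise $|G:\ker\chi|=p^{n-1}\chi(1)$
divides $p^n$, so $\chi$ is faithful of degree $p$. Then $Z(G)$ is cyclic, there is an abelian $A$
of index $p$ (`HasIrr.faithful_dim`), all degrees are $1$ or $p$, and $a\mapsto[g,a]$ on $A$ gives
$|G:G'|=p|Z(G)|$.

The core is `maximalClass_or_card_commutator`, an induction on $n$ using a character of codegree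
$p^{n-2}$. If it is linear, its kernel has order $p^2$ and cyclic quotient, which forces $|G'|=p$.
If it has degree $p$, its kernel $N$ has order $p$ and $G/N$ inherits the hypotheses, with
$|Z(G/N)|=|Z(G)|$ because $N\le G'$. When $G/N$ has maximal class, $N=Z(G)$ and so has $G$. When
$|(G/N)'|=p$ with $N$ of this kind, $G'$ would be central, hence cyclic, of order $p^2$ and exponent
$p$, which is absurd.

If $|G'|=p$ and $G$ has a cyclic quotient of order $p^{n-2}$, a lift $x$ of a generator has order
$p^{n-1}$, and an element outside $\langle x\rangle$ can be corrected by a power of $x$ to have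
order $p$; this gives (2).

For sufficiency, linear characters realise orders of elements of abelian quotients as codegrees, a
cyclic center yields a faithful character, and in maximal class the remaining codegrees come from
the successive central quotients. -/

theorem isIrreducible_iff {G V : Type*} [Monoid G] [AddCommGroup V] [Module ℂ V]
    (ρ : Representation ℂ G V) :
    ρ.IsIrreducible ↔ Nontrivial V ∧
      ∀ W : Submodule ℂ V, (∀ g, ∀ v ∈ W, ρ g v ∈ W) → W = ⊥ ∨ W = ⊤ := by
  constructor
  · intro h
    refine ⟨?_, fun W hW => ?_⟩
    · by_contra hV
      rw [not_nontrivial_iff_subsingleton] at hV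
      obtain ⟨a, b, hab⟩ := h.toNontrivial
      exact hab (Subrepresentation.toSubmodule_injective (Subsingleton.elim _ _))
    · rcases h.eq_bot_or_eq_top ⟨W, fun g v hv => hW g v hv⟩ with h | h
      · exact Or.inl (congrArg Subrepresentation.toSubmodule h)
      · exact Or.inr (congrArg Subrepresentation.toSubmodule h)
  · rintro ⟨hV, h⟩
    refine { exists_pair_ne := ⟨⊥, ⊤, fun e => ?_⟩, eq_bot_or_eq_top := fun W => ?_ }
    · have : (⊥ : Submodule ℂ V) = ⊤ := congrArg Subrepresentation.toSubmodule e
      exact bot_ne_top this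
    · rcases h W.toSubmodule (fun g v hv => W.apply_mem_toSubmodule g hv) with h | h
      · exact Or.inl (Subrepresentation.toSubmodule_injective h)
      · exact Or.inr (Subrepresentation.toSubmodule_injective h)

theorem isIrreducible_comp_iff {G H V : Type*} [Group G] [Group H] [AddCommGroup V] [Module ℂ V]
    (ρ : Representation ℂ H V) (f : G →* H) (hf : Function.Surjective f) :
    Representation.IsIrreducible (ρ.comp f : Representation ℂ G V) ↔ ρ.IsIrreducible := by
  rw [isIrreducible_iff, isIrreducible_iff]
  refine and_congr_right fun _ => forall_congr' fun W => ?_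
  rw [hf.forall]
  rfl

/-- `G` has an irreducible complex representation with kernel `N` and dimension `d`. -/
def HasIrr (G : Type*) [Group G] (N : Subgroup G) (d : ℕ) : Prop :=
  ∃ (V : Type) (_ : AddCommGroup V) (_ : Module ℂ V) (_ : FiniteDimensional ℂ V)
    (ρ : Representation ℂ G V), ρ.IsIrreducible ∧ MonoidHom.ker ρ = N ∧ finrank ℂ V = d

/-- Codegree and degree depend on a character only through its kernel and its value at $1$, which
are the kernel and the dimension of the representation. Characters can thus be replaced by `HasIrr`
and natural numbers. -/
theorem exists_irr_iff {G : Type*} [Group G] [Finite G] (P : Subgroup G → ℂ → Prop) :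
    (∃ χ : Irr G, P (ker χ) (χ.1 1)) ↔ ∃ N d, HasIrr G N d ∧ P N d := by
  constructor
  · rintro ⟨⟨χ, V, _, _, _, ρ, hρ, rfl⟩, h⟩
    refine ⟨MonoidHom.ker ρ, finrank ℂ V, ⟨V, _, _, ‹_›, ρ, hρ, rfl, rfl⟩, ?_⟩
    rw [← ρ.char_one]
    convert h using 1
    ext g
    exact mem_ker_iff ρ g
  · rintro ⟨N, d, ⟨V, _, _, _, ρ, hρ, rfl, rfl⟩, h⟩
    refine ⟨⟨ρ.character, V, _, _, ‹_›, ρ, hρ, rfl⟩, ?_⟩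
    dsimp only
    rw [ρ.char_one]
    convert h using 1
    ext g
    exact (mem_ker_iff ρ g).symm

theorem mem_cod_iff {G : Type*} [Group G] [Finite G] (c : ℂ) :
    c ∈ cod G ↔ ∃ N d, HasIrr G N d ∧ c = (N.index : ℂ) / d :=
  exists_irr_iff fun N d => c = (N.index : ℂ) / d

theorem mem_cd_iff {G : Type*} [Group G] [Finite G] (c : ℂ) :
    c ∈ cd G ↔ ∃ N d, HasIrr G N d ∧ c = d :=
  exists_irr_iff fun _ d => c = d

namespace HasIrr

variable {G : Type u} [Group G]

theorem pos {N : Subgroup G} {d : ℕ} (h : HasIrr G N d) : 0 < d := by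
  obtain ⟨V, _, _, _, ρ, hρ, -, rfl⟩ := h
  have := ((isIrreducible_iff ρ).1 hρ).1
  exact finrank_pos

theorem normal {N : Subgroup G} {d : ℕ} (h : HasIrr G N d) : N.Normal := by
  obtain ⟨V, _, _, _, ρ, hρ, rfl, -⟩ := h
  infer_instance

theorem comap {H : Type*} [Group H] {N : Subgroup H} {d : ℕ} (h : HasIrr H N d) (f : G →* H)
    (hf : Function.Surjective f) : HasIrr G (N.comap f) d := by
  obtain ⟨V, _, _, _, ρ, hρ, rfl, rfl⟩ := h
  exact ⟨V, _, _, ‹_›, ρ.comp f, (isIrreducible_comp_iff ρ f hf).2 hρ, rfl, rfl⟩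

theorem quotient_map {N : Subgroup G} {d : ℕ} (h : HasIrr G N d) (M : Subgroup G) [M.Normal]
    (hM : M ≤ N) : HasIrr (G ⧸ M) (N.map (QuotientGroup.mk' M)) d := by
  obtain ⟨V, _, _, _, ρ, hρ, rfl, rfl⟩ := h
  let σ : Representation ℂ (G ⧸ M) V := QuotientGroup.lift M ρ hM
  have hσ : (σ.comp (QuotientGroup.mk' M) : Representation ℂ G V) = ρ := by
    ext; rfl
  refine ⟨V, _, _, ‹_›, σ, ?_, ?_, rfl⟩
  · rw [← isIrreducible_comp_iff σ _ (QuotientGroup.mk'_surjective M), hσ]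
    exact hρ
  · rw [← Subgroup.map_comap_eq_self_of_surjective (QuotientGroup.mk'_surjective M)
      (MonoidHom.ker σ)]
    congr 1

/-- The regular representation of `G` on `ℂ ^ |G|`. -/
noncomputable def regularRep (G : Type*) [Group G] [Finite G] :
    Representation ℂ G (Fin (Nat.card G) → ℂ) where
  toFun h := LinearMap.funLeft ℂ ℂ fun i =>
    Finite.equivFin G (h⁻¹ * (Finite.equivFin G).symm i)
  map_one' := by
    ext
    simp
  map_mul' a b := by
    ext
    simp [mul_assoc]

theorem regularRep_injective (G : Type*) [Group G] [Finite G] :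
    Function.Injective (regularRep G) := by
  rw [injective_iff_map_eq_one]
  intro h hh
  have := congrFun (LinearMap.congr_fun hh (Pi.single (Finite.equivFin G 1) 1))
    (Finite.equivFin G h)
  simpa [regularRep, LinearMap.funLeft_apply, Pi.single_apply, eq_comm] using this

theorem exists_invariant_isCompl {G V : Type*} [Group G] [Finite G] [AddCommGroup V] [Module ℂ V]
    (ρ : Representation ℂ G V) (U : Subrepresentation ρ) : ∃ U', IsCompl U U' := by
  have : Fintype G := Fintype.ofFinite G
  have : NeZero (Nat.card G : ℂ) := ⟨by exact_mod_cast Nat.card_pos.ne'⟩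
  have h : IsSemisimpleModule (MonoidAlgebra ℂ G) ρ.asModule := inferInstance
  rw [← Representation.isSemisimpleRepresentation_iff_isSemisimpleModule_asModule] at h
  exact h.exists_isCompl U

/-- Some irreducible representation is nontrivial at a given nontrivial element. -/
theorem exists_notMem [Finite G] {g : G} (hg : g ≠ 1) : ∃ N d, HasIrr G N d ∧ g ∉ N := by
  let ρ := regularRep G
  let S : Set (Submodule ℂ (Fin (Nat.card G) → ℂ)) :=
    {W | (∀ h, ∀ v ∈ W, ρ h v ∈ W) ∧ ∃ w ∈ W, ρ g w ≠ w}
  have hS : S.Nonempty := by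
    refine ⟨⊤, fun _ _ _ => trivial, ?_⟩
    by_contra! hc
    refine hg (regularRep_injective G ?_)
    rw [map_one]
    exact LinearMap.ext fun v => hc v trivial
  -- By minimality, `g` fixes every proper invariant subspace of `W` pointwise; this makes `W`
  -- irreducible.
  obtain ⟨W, ⟨hW, w, hw, hgw⟩, hmin⟩ := wellFounded_lt.has_min S hS
  let σ : Representation ℂ G W := (⟨W, hW⟩ : Subrepresentation ρ).toRepresentation
  have hσ : ∀ h (v : W), (σ h v : Fin (Nat.card G) → ℂ) = ρ h v := fun _ _ => rfl
  refine ⟨_, _, ⟨W, inferInstance, inferInstance, inferInstance, σ, ?_, rfl, rfl⟩, ?_⟩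
  · rw [isIrreducible_iff]
    refine ⟨⟨⟨w, hw⟩, 0, fun h => hgw ?_⟩, fun U hU => ?_⟩
    · have : w = 0 := Subtype.ext_iff.1 h
      rw [this, map_zero]
    have key : ∀ X : Submodule ℂ (Fin (Nat.card G) → ℂ), (∀ h, ∀ v ∈ X, ρ h v ∈ X) → X ≤ W →
        X ≠ W → ∀ x ∈ X, ρ g x = x := by
      intro X hX hXW hne x hx
      by_contra hgx
      exact hmin X ⟨hX, x, hx, hgx⟩ (lt_of_le_of_ne hXW hne)
    have hUinv : ∀ h, ∀ v ∈ U.map W.subtype, ρ h v ∈ U.map W.subtype := by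
      rintro h _ ⟨v, hv, rfl⟩
      exact ⟨σ h v, hU h v hv, rfl⟩
    have hUW : U.map W.subtype ≤ W := Submodule.map_subtype_le _ _
    by_cases hUtop : U.map W.subtype = W
    · right
      exact Submodule.map_injective_of_injective W.injective_subtype (by simpa using hUtop)
    left
    -- Split `w = a + b` along a Maschke complement of the proper subspace `U`. Since `g` fixes `a`
    -- but not `w`, it moves `b`, so `W ⊓ U'` is not proper in `W`; then `W ≤ U'` and `U = ⊥`.
    obtain ⟨U', hU'⟩ := exists_invariant_isCompl ρ ⟨U.map W.subtype, hUinv⟩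
    have hsup : ∀ v, ∃ a ∈ U.map W.subtype, ∃ b ∈ U'.toSubmodule, a + b = v := by
      intro v
      have := congrArg Subrepresentation.toSubmodule hU'.sup_eq_top
      rw [Subrepresentation.toSubmodule_sup] at this
      exact Submodule.mem_sup.1 (this ▸ Submodule.mem_top : v ∈ _)
    have hinf : U.map W.subtype ⊓ U'.toSubmodule = ⊥ := by
      have := congrArg Subrepresentation.toSubmodule hU'.inf_eq_bot
      rwa [Subrepresentation.toSubmodule_inf] at this
    obtain ⟨a, ha, b, hb, hab⟩ := hsup w
    have hbW : b ∈ W := by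
      rw [← add_sub_cancel_left a b, hab]
      exact W.sub_mem hw (hUW ha)
    have hga := key _ hUinv hUW hUtop a ha
    have hU'W : W ≤ U'.toSubmodule := by
      by_contra hne
      have := key (W ⊓ U'.toSubmodule)
        (fun h v hv => ⟨hW h v hv.1, U'.apply_mem_toSubmodule h hv.2⟩) inf_le_left
        (fun h => hne (inf_eq_left.1 h)) b ⟨hbW, hb⟩
      apply hgw
      rw [← hab, map_add, hga, this]
    have : U.map W.subtype = ⊥ := by
      rw [← hinf]
      exact (inf_eq_left.2 (hUW.trans hU'W)).symm
    exact Submodule.map_injective_of_injective W.injective_subtype (by simpa using this)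
  · intro hm
    rw [MonoidHom.mem_ker] at hm
    apply hgw
    have := hσ g ⟨w, hw⟩
    rw [hm] at this
    exact this.symm

end HasIrr

end FiniteGroupCharacters

/-! ### Linear characters, central elements and bounds on dimensions -/

namespace FiniteGroupCharacters

open Module
open scoped commutatorElement

universe u

theorem mk_commute_of_commutator_le {G : Type*} [Group G] {N : Subgroup G} [N.Normal] (h : commutator G ≤ N)
    (a b : G ⧸ N) : a * b = b * a := by
  obtain ⟨a, rfl⟩ := QuotientGroup.mk_surjective a
  obtain ⟨b, rfl⟩ := QuotientGroup.mk_surjective b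
  rw [← QuotientGroup.mk_mul, ← QuotientGroup.mk_mul, QuotientGroup.eq]
  apply h
  have : (a * b)⁻¹ * (b * a) = ⁅b⁻¹, a⁻¹⁆ := by
    rw [commutatorElement_def]; group
  rw [this, commutator_def]
  exact Subgroup.commutator_mem_commutator (Subgroup.mem_top _) (Subgroup.mem_top _)

namespace HasIrr

variable {G : Type u} [Group G]

/-- In dimension one an endomorphism is a scalar equal to its determinant, so the determinant of the
representation is the required character. -/
theorem exists_hom {N : Subgroup G} (h : HasIrr G N 1) : ∃ f : G →* ℂˣ, f.ker = N := by
  obtain ⟨V, _, _, _, ρ, hρ, rfl, hd⟩ := h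
  refine ⟨((LinearMap.det (A := ℂ) (M := V)).comp ρ).toHomUnits, ?_⟩
  ext g
  rw [MonoidHom.mem_ker, MonoidHom.mem_ker, Units.ext_iff, MonoidHom.coe_toHomUnits]
  obtain ⟨c, hc, -⟩ := LinearMap.existsUnique_eq_smul_id_of_finrank_eq_one hd (ρ g)
  constructor
  · intro h
    have h1 : LinearMap.det (ρ g) = 1 := h
    rw [hc, LinearMap.det_smul, hd, pow_one, LinearMap.det_id, mul_one] at h1
    rw [hc, h1, one_smul]
    rfl
  · intro h
    change LinearMap.det (ρ g) = 1
    rw [h, map_one]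

theorem of_hom (f : G →* ℂˣ) : HasIrr G f.ker 1 := by
  let ρ : Representation ℂ G ℂ :=
    ((algebraMap ℂ (Module.End ℂ ℂ) : ℂ →* Module.End ℂ ℂ).comp (Units.coeHom ℂ)).comp f
  refine ⟨ℂ, inferInstance, inferInstance, inferInstance, ρ, ?_, ?_, finrank_self ℂ⟩
  · exact (isIrreducible_iff ρ).2 ⟨inferInstance, fun W _ => eq_bot_or_eq_top W⟩
  · ext g
    rw [MonoidHom.mem_ker, MonoidHom.mem_ker]
    constructor
    · intro h
      have := LinearMap.congr_fun h 1
      rw [Units.ext_iff]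
      simpa [ρ] using this
    · intro h
      simp [ρ, h]

theorem isCyclic_quotient [Finite G] {N : Subgroup G} [N.Normal] (h : HasIrr G N 1) :
    IsCyclic (G ⧸ N) := by
  obtain ⟨f, rfl⟩ := h.exists_hom
  exact isCyclic_of_injective_ringHom ((Units.coeHom ℂ).comp (QuotientGroup.kerLift f))
    (Units.val_injective.comp (QuotientGroup.kerLift_injective f))

theorem commutator_le {N : Subgroup G} (h : HasIrr G N 1) : commutator G ≤ N := by
  obtain ⟨f, rfl⟩ := h.exists_hom
  exact Abelianization.commutator_subset_ker f

theorem dim_eq_one_of_comm {d : ℕ} {N : Subgroup G} (h : HasIrr G N d)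
    (hG : ∀ a b : G, a * b = b * a) : d = 1 := by
  obtain ⟨V, _, _, _, ρ, hρ, -, rfl⟩ := h
  have : IsMulCommutative G := ⟨⟨hG⟩⟩
  exact hρ.finrank_eq_one_of_isMulCommutative

theorem dim_eq_one_of_commutator_le {d : ℕ} {N : Subgroup G} (h : HasIrr G N d)
    (hN : commutator G ≤ N) : d = 1 := by
  have := h.normal
  have h' := h.quotient_map N le_rfl
  exact h'.dim_eq_one_of_comm (mk_commute_of_commutator_le hN)

/-- Central elements act as scalars in an irreducible representation. -/
theorem _root_.FiniteGroupCharacters.exists_smul_of_mem_center {V : Type*} [AddCommGroup V]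
    [Module ℂ V] [FiniteDimensional ℂ V] (ρ : Representation ℂ G V) (hρ : ρ.IsIrreducible) {z : G}
    (hz : z ∈ Subgroup.center G) : ∃ c : ℂ, ∀ v, ρ z v = c • v := by
  obtain ⟨hV, h⟩ := (isIrreducible_iff ρ).1 hρ
  obtain ⟨c, hc⟩ := Module.End.exists_eigenvalue (ρ z)
  refine ⟨c, fun v => ?_⟩
  have := (h (Module.End.eigenspace (ρ z) c) fun g v hv => ?_).resolve_left hc
  · exact Module.End.mem_eigenspace_iff.1 (this ▸ Submodule.mem_top)
  · rw [Module.End.mem_eigenspace_iff] at hv ⊢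
    rw [← Module.End.mul_apply, ← map_mul, ← Subgroup.mem_center_iff.1 hz g, map_mul,
      Module.End.mul_apply, hv, map_smul]

/-- The scalars by which the center acts embed it into the multiplicative monoid of a field, since
the representation is faithful. -/
theorem isCyclic_center [Finite G] {d : ℕ} (h : HasIrr G ⊥ d) :
    IsCyclic (Subgroup.center G) := by
  obtain ⟨V, _, _, _, ρ, hρ, hk, -⟩ := h
  obtain ⟨hV, -⟩ := (isIrreducible_iff ρ).1 hρ
  obtain ⟨v, hv⟩ := exists_ne (0 : V)
  choose c hc using fun z : Subgroup.center G => exists_smul_of_mem_center ρ hρ z.2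
  have huniq : ∀ (z : Subgroup.center G) (a : ℂ), ρ z v = a • v → c z = a := fun z a ha =>
    smul_left_injective ℂ hv (show c z • v = a • v by rw [← hc, ha])
  let f : Subgroup.center G →* ℂ :=
    { toFun := c
      map_one' := huniq _ _ (by simp)
      map_mul' := fun a b => huniq _ _ (by
        rw [Subgroup.coe_mul, map_mul, Module.End.mul_apply, hc, hc, smul_smul]) }
  refine isCyclic_of_injective_ringHom f fun a b hab => ?_
  have hinj := (MonoidHom.ker_eq_bot_iff ρ).1 hk
  refine Subtype.ext (hinj (LinearMap.ext fun w => ?_))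
  rw [hc, hc]
  exact congrArg (· • w) hab

/-- A commutative subgroup of finite index bounds the dimensions of irreducible representations. -/
theorem le_index [Finite G] {N : Subgroup G} {d : ℕ} (h : HasIrr G N d) (A : Subgroup G)
    (hA : ∀ a ∈ A, ∀ b ∈ A, a * b = b * a) : d ≤ A.index := by
  obtain ⟨V, _, _, _, ρ, hρ, -, rfl⟩ := h
  obtain ⟨hV, h⟩ := (isIrreducible_iff ρ).1 hρ
  -- A minimal nonzero `A`-invariant subspace lies in one eigenspace of each `a ∈ A`, because `A` is
  -- commutative. Its vector `v` is thus a common eigenvector.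
  obtain ⟨W, ⟨hWinv, hW0⟩, hmin⟩ := wellFounded_lt.has_min
    {W : Submodule ℂ V | (∀ a ∈ A, ∀ v ∈ W, ρ a v ∈ W) ∧ W ≠ ⊥}
    ⟨⊤, fun _ _ _ _ => trivial, top_ne_bot⟩
  obtain ⟨v, hvW, hv⟩ := Submodule.exists_mem_ne_zero_of_ne_bot hW0
  have hscal : ∀ a ∈ A, ∃ c : ℂ, ρ a v = c • v := by
    intro a ha
    have : Nontrivial W := Submodule.nontrivial_iff_ne_bot.2 hW0
    obtain ⟨c, hc⟩ := Module.End.exists_eigenvalue ((ρ a).restrict (hWinv a ha))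
    obtain ⟨w, hw⟩ := hc.exists_hasEigenvector
    have hw1 : ρ a w = c • (w : V) := congrArg Subtype.val hw.apply_eq_smul
    refine ⟨c, ?_⟩
    by_contra hne
    refine hmin (W ⊓ Module.End.eigenspace (ρ a) c) ⟨fun b hb x hx => ⟨hWinv b hb x hx.1, ?_⟩, ?_⟩
      (lt_of_le_of_ne inf_le_left fun he => hne ?_)
    · have hx2 := Module.End.mem_eigenspace_iff.1 hx.2
      apply Module.End.mem_eigenspace_iff.2
      rw [← Module.End.mul_apply, ← map_mul, hA a ha b hb, map_mul, Module.End.mul_apply, hx2,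
        map_smul]
    · rw [Submodule.ne_bot_iff]
      exact ⟨w, ⟨w.2, Module.End.mem_eigenspace_iff.2 hw1⟩, fun h0 => hw.2 (Subtype.ext h0)⟩
    · rw [← he] at hvW
      exact Module.End.mem_eigenspace_iff.1 hvW.2
  -- One translate of `v` per coset of `A` suffices to span `V`, since `A` only rescales `v`.
  let S : Submodule ℂ V := Submodule.span ℂ (Set.range fun q : G ⧸ A => ρ q.out v)
  have hmem : ∀ g, ρ g v ∈ S := by
    intro g
    obtain ⟨a, ha⟩ := QuotientGroup.mk_out_eq_mul A g
    obtain ⟨c, hc⟩ := hscal (a : G)⁻¹ (A.inv_mem a.2)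
    have hg : g = (QuotientGroup.mk g : G ⧸ A).out * (a : G)⁻¹ := by rw [ha]; group
    rw [hg, map_mul, Module.End.mul_apply, hc, map_smul]
    exact S.smul_mem c (Submodule.subset_span ⟨_, rfl⟩)
  have hS : S = ⊤ := by
    refine (h S fun g x hx => ?_).resolve_left ?_
    · induction hx using Submodule.span_induction with
      | mem x hx =>
        obtain ⟨q, rfl⟩ := hx
        rw [← Module.End.mul_apply, ← map_mul]
        exact hmem _
      | zero => rw [map_zero]; exact S.zero_mem
      | add x y _ _ hx hy => rw [map_add]; exact S.add_mem hx hy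
      | smul a x _ hx => rw [map_smul]; exact S.smul_mem a hx
    · exact (Submodule.ne_bot_iff _).2 ⟨v, by simpa using hmem 1, hv⟩
  have : Fintype (G ⧸ A) := Fintype.ofFinite _
  rw [← finrank_top, ← hS, Subgroup.index_eq_card, Nat.card_eq_fintype_card]
  exact finrank_range_le_card _

end HasIrr

/-- A noncommutative finite nilpotent group has a noncentral element that is central modulo the
center. -/
theorem exists_notMem_center {G : Type*} [Group G] [Group.IsNilpotent G]
    (hG : ¬ ∀ a b : G, a * b = b * a) :
    ∃ x ∉ Subgroup.center G, ∀ g, g * x * g⁻¹ * x⁻¹ ∈ Subgroup.center G := by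
  have : Nontrivial (G ⧸ Subgroup.center G) := by
    rw [QuotientGroup.nontrivial_iff]
    intro h
    exact hG fun a b => (Subgroup.mem_center_iff.1 (h ▸ Subgroup.mem_top b) a)
  have h := Group.IsNilpotent.center_ne_bot (G := G ⧸ Subgroup.center G)
  obtain ⟨⟨q, hq⟩, hq1⟩ := Subgroup.ne_bot_iff_exists_ne_one.1 h
  replace hq1 : q ≠ 1 := fun h => hq1 (Subtype.ext h)
  obtain ⟨x, hx⟩ := QuotientGroup.mk_surjective q
  rw [← hx] at hq hq1
  refine ⟨x, fun h => hq1 ((QuotientGroup.eq_one_iff x).2 h), fun g => ?_⟩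
  rw [← QuotientGroup.eq_one_iff]
  have := Subgroup.mem_center_iff.1 hq g
  rw [QuotientGroup.mk_mul, QuotientGroup.mk_mul, QuotientGroup.mk_mul, this,
    QuotientGroup.mk_inv, QuotientGroup.mk_inv]
  group

/-- `X` has simple spectrum, so whatever commutes with it preserves each eigenline and is diagonal
in the basis `b`. -/
theorem commute_of_basis_eigenvectors {V ι : Type*} [AddCommGroup V] [Module ℂ V]
    (X : Module.End ℂ V) (b : Basis ι ℂ V) (μ : ι → ℂ) (hμ : Function.Injective μ)
    (hb : ∀ i, X (b i) = μ i • b i) (S T : Module.End ℂ V) (hS : Commute S X) (hT : Commute T X) :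
    S * T = T * S := by
  have key : ∀ S : Module.End ℂ V, Commute S X → ∀ i, ∃ c : ℂ, S (b i) = c • b i := by
    intro S hS i
    have h1 : X (S (b i)) = μ i • S (b i) := by
      rw [← Module.End.mul_apply, ← hS.eq, Module.End.mul_apply, hb, map_smul]
    have hcoord : ∀ v j, b.repr (X v) j = μ j * b.repr v j := by
      intro v j
      have : (b.coord j).comp X = μ j • b.coord j := by
        refine b.ext fun k => ?_
        simp only [LinearMap.comp_apply, hb, map_smul, LinearMap.smul_apply, smul_eq_mul,
          Basis.coord_apply, Basis.repr_self]
        by_cases hkj : k = j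
        · rw [hkj]
        · simp [hkj]
      exact LinearMap.congr_fun this v
    refine ⟨b.repr (S (b i)) i, b.repr.injective (Finsupp.ext fun j => ?_)⟩
    by_cases hij : i = j
    · subst hij; simp
    · have h2 := hcoord (S (b i)) j
      rw [h1, map_smul, Finsupp.smul_apply, smul_eq_mul] at h2
      have h3 : (μ i - μ j) * b.repr (S (b i)) j = 0 := by rw [sub_mul, h2, sub_self]
      rcases mul_eq_zero.1 h3 with h | h
      · exact absurd (hμ (sub_eq_zero.1 h)) hij
      · rw [h]
        simp [hij]
  refine b.ext fun i => ?_
  obtain ⟨c, hc⟩ := key S hS i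
  obtain ⟨e, he⟩ := key T hT i
  rw [Module.End.mul_apply, Module.End.mul_apply, hc, he, map_smul, map_smul, hc, he, smul_comm]

/-- A faithful irreducible representation of a noncommutative `p`-group has dimension at least `p`,
and if the dimension is `p` there is a commutative subgroup of index `p`. -/
theorem HasIrr.faithful_dim {G : Type u} [Group G] [Finite G] {p d : ℕ} [Fact p.Prime]
    (hG : IsPGroup p G) (hcomm : ¬ ∀ a b : G, a * b = b * a) (h : HasIrr G ⊥ d) :
    p ≤ d ∧ (d = p → ∃ A : Subgroup G, A.index = p ∧ ∀ a ∈ A, ∀ b ∈ A, a * b = b * a) := by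
  obtain ⟨V, _, _, _, ρ, hρ, hk, rfl⟩ := h
  have hinj := (MonoidHom.ker_eq_bot_iff ρ).1 hk
  obtain ⟨hV, -⟩ := (isIrreducible_iff ρ).1 hρ
  have := hG.isNilpotent
  obtain ⟨x, hx, hxc⟩ := exists_notMem_center hcomm
  obtain ⟨μ, hμ⟩ := Module.End.exists_eigenvalue (ρ x)
  obtain ⟨v, hv⟩ := hμ.exists_hasEigenvector
  have hxinv : ∀ w, ρ x⁻¹ (ρ x w) = w := fun w => by
    rw [← Module.End.mul_apply, ← map_mul, inv_mul_cancel, map_one, Module.End.one_apply]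
  have hμ0 : μ ≠ 0 := by
    rintro rfl
    apply hv.2
    rw [← hxinv v, hv.apply_eq_smul, zero_smul, map_zero]
  -- The commutator of `g` and `x` is central and acts as the scalar `c g`. Hence `ρ g⁻¹ v` is again
  -- an eigenvector of `ρ x`, with eigenvalue `c g * μ`; by faithfulness, distinct cosets of the
  -- centralizer `C` give distinct eigenvalues, so `C.index` is at most the dimension.
  choose c hc using fun g => exists_smul_of_mem_center ρ hρ (hxc g)
  let C := Subgroup.centralizer {x}
  have hev : ∀ g, Module.End.HasEigenvector (ρ x) (c g * μ) (ρ g⁻¹ v) := by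
    intro g
    refine ⟨Module.End.mem_eigenspace_iff.2 ?_, fun h0 => hv.2 ?_⟩
    · have : x * g⁻¹ = g⁻¹ * (g * x * g⁻¹ * x⁻¹) * x := by group
      rw [← Module.End.mul_apply, ← map_mul, this, map_mul, map_mul, Module.End.mul_apply,
        Module.End.mul_apply, hv.apply_eq_smul, hc, map_smul, map_smul, smul_smul]
    · have : ρ g (ρ g⁻¹ v) = v := by
        rw [← Module.End.mul_apply, ← map_mul, mul_inv_cancel, map_one, Module.End.one_apply]
      rw [← this, h0, map_zero]
  have hcinj : ∀ g k, c g = c k → (QuotientGroup.mk g : G ⧸ C) = QuotientGroup.mk k := by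
    intro g k hgk
    have h1 : g * x * g⁻¹ * x⁻¹ = k * x * k⁻¹ * x⁻¹ :=
      hinj (LinearMap.ext fun w => by rw [hc, hc, hgk])
    rw [QuotientGroup.eq, Subgroup.mem_centralizer_singleton_iff]
    have h2 := mul_right_cancel h1
    calc g⁻¹ * k * x = g⁻¹ * (k * x * k⁻¹) * k := by group
      _ = g⁻¹ * (g * x * g⁻¹) * k := by rw [h2]
      _ = x * (g⁻¹ * k) := by group
  let ν : G ⧸ C → ℂ := fun q => c q.out * μ
  have hν : Function.Injective ν := by
    intro q r hqr
    have := hcinj _ _ (mul_right_cancel₀ hμ0 hqr)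
    rwa [QuotientGroup.out_eq', QuotientGroup.out_eq'] at this
  have hli := Module.End.eigenvectors_linearIndependent' (ρ x) ν hν (fun q => ρ q.out⁻¹ v)
    (fun q => hev q.out)
  have hle : C.index ≤ finrank ℂ V := by
    have : Fintype (G ⧸ C) := Fintype.ofFinite _
    rw [Subgroup.index_eq_card, Nat.card_eq_fintype_card]
    exact hli.fintype_card_le_finrank
  obtain ⟨k, hk⟩ := hG.index C
  have hk0 : k ≠ 0 := by
    rintro rfl
    rw [pow_zero, Subgroup.index_eq_one] at hk
    apply hx
    rw [Subgroup.mem_center_iff]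
    intro g
    exact Subgroup.mem_centralizer_singleton_iff.1 (hk ▸ Subgroup.mem_top g : g ∈ C)
  have hpC : p ≤ C.index := hk ▸ Nat.le_self_pow hk0 p
  refine ⟨hpC.trans hle, fun hd => ⟨C, le_antisymm (hd ▸ hle) hpC, fun a ha b hb => ?_⟩⟩
  have : Fintype (G ⧸ C) := Fintype.ofFinite _
  -- In dimension `p` these eigenvectors form a basis with distinct eigenvalues, so all operators
  -- from `C` commute.
  let B := basisOfLinearIndependentOfCardEqFinrank hli (by
    rw [← Nat.card_eq_fintype_card, ← Subgroup.index_eq_card]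
    exact le_antisymm hle (hd ▸ hpC))
  have hcx : ∀ a ∈ C, Commute (ρ a) (ρ x) := fun a ha => by
    rw [commute_iff_eq, ← map_mul, ← map_mul, Subgroup.mem_centralizer_singleton_iff.1 ha]
  apply hinj
  rw [map_mul, map_mul]
  refine commute_of_basis_eigenvectors (ρ x) B ν hν (fun q => ?_) _ _ (hcx a ha) (hcx b hb)
  rw [coe_basisOfLinearIndependentOfCardEqFinrank]
  exact (hev q.out).apply_eq_smul

end FiniteGroupCharacters

/-! ### Finite p-groups and commutative subgroups of prime index -/

namespace FiniteGroupCharacters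

open Subgroup
open scoped commutatorElement

section PGroup

variable {G : Type*} [Group G]

theorem comm_of_isCyclic_quotient {N : Subgroup G} [N.Normal] (hN : N ≤ center G)
    (h : IsCyclic (G ⧸ N)) (a b : G) : a * b = b * a :=
  ((QuotientGroup.mk' N).isMulCommutative_of_isCyclic_of_ker_le_center
    ((QuotientGroup.ker_mk' N).trans_le hN)).is_comm.comm a b

theorem commutator_le_of_comm_quotient {N : Subgroup G} [N.Normal]
    (h : ∀ a b : G ⧸ N, a * b = b * a) : commutator G ≤ N := by
  rw [commutator_def, commutator_le]
  intro a _ b _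
  rw [← QuotientGroup.eq_one_iff, commutatorElement_def]
  simp only [QuotientGroup.mk_mul, QuotientGroup.mk_inv]
  rw [h a b]
  group

theorem commutator_eq_bot_iff_comm : commutator G = ⊥ ↔ ∀ a b : G, a * b = b * a := by
  rw [commutator_eq_bot_iff_center_eq_top, eq_top_iff]
  constructor
  · intro h a b
    exact mem_center_iff.1 (h (mem_top b)) a
  · intro h b _
    exact mem_center_iff.2 fun a => h a b

/-- Conjugation on `N` fixes `1`, and $p$ divides $|N|$, so the fixed-point count modulo $p$
provides another fixed point. -/
theorem inf_center_ne_bot [Finite G] {p : ℕ} [Fact p.Prime] (hG : IsPGroup p G) (N : Subgroup G)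
    [N.Normal] (hN : N ≠ ⊥) : N ⊓ center G ≠ ⊥ := by
  have hC : IsPGroup p (ConjAct G) := hG
  have hp : p ∣ Nat.card N := ((hG.to_subgroup N).card_eq_or_dvd).resolve_left
    fun h => hN (N.eq_bot_of_card_eq h)
  obtain ⟨b, hb, hb1⟩ := hC.exists_fixed_point_of_prime_dvd_card_of_fixed_point N hp
    (a := (1 : N)) (fun g => smul_one g)
  rw [Subgroup.ne_bot_iff_exists_ne_one]
  refine ⟨⟨b, b.2, mem_center_iff.2 fun g => ?_⟩, fun h => hb1 ?_⟩
  · have := congrArg Subtype.val (hb (ConjAct.toConjAct g))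
    rw [ConjAct.Subgroup.val_conj_smul, ConjAct.smul_def, ConjAct.ofConjAct_toConjAct] at this
    exact mul_inv_eq_iff_eq_mul.1 this
  · exact Subtype.ext (Subtype.ext_iff.1 h).symm

theorem le_center_of_card_eq_prime [Finite G] {p : ℕ} [Fact p.Prime] (hG : IsPGroup p G)
    (N : Subgroup G) [N.Normal] (hN : Nat.card N = p) : N ≤ center G := by
  have hne : N ≠ ⊥ := by
    rintro rfl
    rw [card_bot] at hN
    exact (Fact.out : p.Prime).one_lt.ne hN
  have h1 := inf_center_ne_bot hG N hne
  have h2 : Nat.card (N ⊓ center G : Subgroup G) ∣ p := hN ▸ card_dvd_of_le inf_le_left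
  rcases (Nat.dvd_prime Fact.out).1 h2 with h | h
  · exact absurd ((N ⊓ center G).eq_bot_of_card_eq h) h1
  · have := eq_of_le_of_card_ge (inf_le_left : N ⊓ center G ≤ N) (by rw [h, hN])
    exact inf_eq_left.1 this

/-- In a `p`-group with cyclic center, a normal subgroup of order `p` lies in every nontrivial
normal subgroup. -/
theorem le_of_isCyclic_center [Finite G] {p : ℕ} [Fact p.Prime] (hG : IsPGroup p G)
    [IsCyclic (center G)] (M : Subgroup G) [M.Normal] (hM : Nat.card M = p) (N : Subgroup G)
    [N.Normal] (hN : N ≠ ⊥) : M ≤ N := by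
  have hMc := le_center_of_card_eq_prime hG M hM
  have hne := inf_center_ne_bot hG N hN
  have hp : p ∣ Nat.card (N ⊓ center G : Subgroup G) :=
    ((hG.to_subgroup _).card_eq_or_dvd).resolve_left fun h => hne (eq_bot_of_card_eq _ h)
  obtain ⟨⟨y, hyN, hyc⟩, hy⟩ := exists_prime_orderOf_dvd_card' p hp
  replace hy : orderOf y = p := (orderOf_mk _ _).symm.trans hy
  let : CommGroup (center G) := IsCyclic.commGroup
  -- In a cyclic center the solutions of $z^p=1$ number at most $p$; they are therefore the powers
  -- of `y ∈ N`, and they include `M`.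
  let K : Subgroup (center G) := (powMonoidHom p : center G →* center G).ker
  have hK : Nat.card K ≤ p := by
    rw [IsCyclic.card_powMonoidHom_ker]
    exact Nat.gcd_le_right _ (Fact.out : p.Prime).pos
  let y' : center G := ⟨y, hyc⟩
  have hyo : orderOf y' = p := by rw [orderOf_mk, hy]
  have hzK : zpowers y' = K := by
    refine eq_of_le_of_card_ge ?_ (by rwa [Nat.card_zpowers, hyo])
    rw [zpowers_le, MonoidHom.mem_ker, powMonoidHom_apply, ← hyo, pow_orderOf_eq_one]
  intro m hm
  have hmK : (⟨m, hMc hm⟩ : center G) ∈ K := by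
    rw [MonoidHom.mem_ker, powMonoidHom_apply]
    apply Subtype.ext
    have : (⟨m, hm⟩ : M) ^ p = 1 := by rw [← hM, pow_card_eq_one']
    have hmp : m ^ p = 1 := congrArg Subtype.val this
    exact hmp
  rw [← hzK, mem_zpowers_iff] at hmK
  obtain ⟨k, hk⟩ := hmK
  have : y ^ k = m := congrArg Subtype.val hk
  rw [← this]
  exact N.zpow_mem hyN k

/-- Induction on central quotients: once $G/Z(G)$ is commutative, $G'\le Z(G)$, so $G/Z(G)$ is a
quotient of the cyclic abelianization. -/
theorem comm_of_isCyclic_abelianization [hn : Group.IsNilpotent G]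
    (h : IsCyclic (Abelianization G)) : ∀ a b : G, a * b = b * a := by
  revert h
  refine Group.nilpotent_center_quotient_ind (P := fun G _ _ =>
    IsCyclic (Abelianization G) → ∀ a b : G, a * b = b * a) G ?_ ?_
  · intro G _ _ _ a b
    exact Subsingleton.elim _ _
  · intro G _ _ ih h
    have h1 : IsCyclic (Abelianization (G ⧸ center G)) := by
      refine isCyclic_of_surjective (Abelianization.map (QuotientGroup.mk' (center G))) ?_
      intro q
      obtain ⟨q, rfl⟩ := QuotientGroup.mk_surjective q
      obtain ⟨g, rfl⟩ := QuotientGroup.mk_surjective q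
      exact ⟨Abelianization.of g, rfl⟩
    have hle : commutator G ≤ center G := commutator_le_of_comm_quotient (ih h1)
    have h2 : IsCyclic (G ⧸ center G) :=
      isCyclic_of_surjective (G' := Abelianization G) (QuotientGroup.map (commutator G) (center G) (MonoidHom.id G) hle)
        (fun q => by
          obtain ⟨g, rfl⟩ := QuotientGroup.mk_surjective q
          exact ⟨QuotientGroup.mk g, rfl⟩)
    exact comm_of_isCyclic_quotient le_rfl h2

theorem normal_of_index_eq_prime [Finite G] {p : ℕ} [hp : Fact p.Prime] (hG : IsPGroup p G)
    (A : Subgroup G) (hA : A.index = p) : A.Normal := by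
  apply normal_of_index_eq_minFac_card
  obtain ⟨n, hn⟩ := IsPGroup.iff_card.1 hG
  have hn0 : n ≠ 0 := by
    rintro rfl
    have := A.index_dvd_card
    rw [hA, hn, pow_zero, Nat.dvd_one] at this
    exact hp.out.one_lt.ne' this
  rw [hA, hn, hp.out.pow_minFac hn0]

theorem exists_zpow_mul {p : ℕ} [hp : Fact p.Prime] {A : Subgroup G} [A.Normal] (hA : A.index = p)
    {g : G} (hg : g ∉ A) (h : G) : ∃ k : ℤ, ∃ a ∈ A, h = g ^ k * a := by
  have h1 : zpowers (QuotientGroup.mk g : G ⧸ A) = ⊤ :=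
    zpowers_eq_top_of_prime_card (p := p) hA (fun h => hg ((QuotientGroup.eq_one_iff g).1 h))
  obtain ⟨k, hk⟩ := mem_zpowers_iff.1 (h1 ▸ mem_top (QuotientGroup.mk h) : _ ∈ zpowers _)
  refine ⟨k, (g ^ k)⁻¹ * h, ?_, by group⟩
  rw [← QuotientGroup.eq, QuotientGroup.mk_zpow, hk]

theorem mem_center_of_commute {p : ℕ} [hp : Fact p.Prime] {A : Subgroup G} [A.Normal]
    (hA : A.index = p) (hcomm : ∀ a ∈ A, ∀ b ∈ A, a * b = b * a) {g : G} (hg : g ∉ A) {a : G}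
    (ha : a ∈ A) (hga : Commute g a) : a ∈ center G := by
  rw [mem_center_iff]
  intro h
  obtain ⟨k, b, hb, rfl⟩ := exists_zpow_mul hA hg h
  exact ((hga.zpow_left k).mul_left (hcomm b hb a ha)).eq

/-- A central element outside `A` would generate `G` together with `A` and commute with it, making
`G` commutative. -/
theorem center_le_of_index {p : ℕ} [hp : Fact p.Prime] {A : Subgroup G} [A.Normal]
    (hA : A.index = p) (hcomm : ∀ a ∈ A, ∀ b ∈ A, a * b = b * a)
    (hG : ¬ ∀ a b : G, a * b = b * a) : center G ≤ A := by
  intro z hz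
  by_contra hzA
  have hAc : A ≤ center G := fun a ha =>
    mem_center_of_commute hA hcomm hzA ha (mem_center_iff.1 hz a).symm
  refine hG fun a b => ?_
  obtain ⟨k, b, hb, rfl⟩ := exists_zpow_mul hA hzA b
  exact mem_center_iff.1 ((center G).mul_mem ((center G).zpow_mem hz k) (hAc hb)) a

/-- If `A` is a commutative normal subgroup of prime index and `g ∉ A`, then `a ↦ [g, a]` is a
homomorphism from `A` onto the commutator subgroup, with kernel the center. -/
theorem exists_commutator_hom {p : ℕ} [hp : Fact p.Prime] {A : Subgroup G} [hAn : A.Normal]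
    (hA : A.index = p) (hcomm : ∀ a ∈ A, ∀ b ∈ A, a * b = b * a)
    {g : G} (hg : g ∉ A) :
    ∃ f : A →* G, (∀ a : A, f a = g * a * g⁻¹ * (a : G)⁻¹) ∧ f.range = commutator G ∧
      f.ker = (center G).subgroupOf A := by
  let f : A →* G :=
    { toFun := fun a => g * a * g⁻¹ * (a : G)⁻¹
      map_one' := by simp
      map_mul' := fun a b => by
        have h1 : (g * b * g⁻¹ * (b : G)⁻¹) * (a : G)⁻¹ = (a : G)⁻¹ * (g * b * g⁻¹ * (b : G)⁻¹) :=
          hcomm _ (A.mul_mem (hAn.conj_mem b b.2 g) (A.inv_mem b.2)) _ (A.inv_mem a.2)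
        calc g * ((a * b : A) : G) * g⁻¹ * ((a * b : A) : G)⁻¹
            = g * a * g⁻¹ * ((g * b * g⁻¹ * (b : G)⁻¹) * (a : G)⁻¹) := by
              rw [Subgroup.coe_mul]; group
          _ = _ := by rw [h1]; group }
  have hf : ∀ a : A, f a = g * a * g⁻¹ * (a : G)⁻¹ := fun _ => rfl
  refine ⟨f, hf, le_antisymm ?_ ?_, ?_⟩
  · rintro _ ⟨a, rfl⟩
    rw [hf, ← commutatorElement_def, commutator_def]
    exact commutator_mem_commutator (mem_top _) (mem_top _)
  -- The range is normal, and modulo it `g` commutes with `A`; as `g` and `A` generate `G`, the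
  -- quotient is commutative.
  · have hfA : ∀ a, f a ∈ A := fun a => A.mul_mem (hAn.conj_mem a a.2 g) (A.inv_mem a.2)
    have : f.range.Normal := by
      constructor
      rintro _ ⟨a, rfl⟩ h
      obtain ⟨k, b, hb, rfl⟩ := exists_zpow_mul hA hg h
      refine ⟨⟨g ^ k * a * (g ^ k)⁻¹, hAn.conj_mem a a.2 _⟩, ?_⟩
      have h1 : b * f a = f a * b := hcomm b hb _ (hfA a)
      calc f ⟨g ^ k * a * (g ^ k)⁻¹, hAn.conj_mem a a.2 _⟩ = g ^ k * f a * (g ^ k)⁻¹ := by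
            rw [hf, hf]; group
        _ = g ^ k * (f a * b) * b⁻¹ * (g ^ k)⁻¹ := by group
        _ = g ^ k * b * f a * (g ^ k * b)⁻¹ := by rw [← h1]; group
    have hga : ∀ a ∈ A, Commute (g : G ⧸ f.range) (a : G ⧸ f.range) := by
      intro a ha
      have : ((g * a * g⁻¹ * a⁻¹ : G) : G ⧸ f.range) = 1 :=
        (QuotientGroup.eq_one_iff _).2 ⟨⟨a, ha⟩, rfl⟩
      simp only [QuotientGroup.mk_mul, QuotientGroup.mk_inv] at this
      rw [mul_inv_eq_one, mul_inv_eq_iff_eq_mul] at this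
      exact this
    apply commutator_le_of_comm_quotient
    intro x y
    obtain ⟨x, rfl⟩ := QuotientGroup.mk_surjective x
    obtain ⟨y, rfl⟩ := QuotientGroup.mk_surjective y
    obtain ⟨i, a, ha, rfl⟩ := exists_zpow_mul hA hg x
    obtain ⟨j, b, hb, rfl⟩ := exists_zpow_mul hA hg y
    simp only [QuotientGroup.mk_mul, QuotientGroup.mk_zpow]
    have hab : Commute (a : G ⧸ f.range) (b : G ⧸ f.range) :=
      congrArg (QuotientGroup.mk' f.range) (hcomm a ha b hb)
    have h1 := (Commute.refl (g : G ⧸ f.range)).zpow_zpow i j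
    have h2 := (hga b hb).zpow_left i
    have h3 := ((hga a ha).zpow_left j).symm
    exact (h1.mul_right h2).mul_left (h3.mul_right hab)
  · ext a
    rw [MonoidHom.mem_ker, hf, mem_subgroupOf, mul_inv_eq_one, mul_inv_eq_iff_eq_mul]
    exact ⟨fun h => mem_center_of_commute hA hcomm hg a.2 h, fun h => mem_center_iff.1 h g⟩

/-- The commutator homomorphism on `A` gives $|A|=|Z(G)|\,|G'|$. -/
theorem index_commutator [Finite G] {p : ℕ} [hp : Fact p.Prime] {A : Subgroup G} [hAn : A.Normal]
    (hA : A.index = p) (hcomm : ∀ a ∈ A, ∀ b ∈ A, a * b = b * a)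
    (hG : ¬ ∀ a b : G, a * b = b * a) :
    (commutator G).index = p * Nat.card (center G) := by
  obtain ⟨g, hg⟩ : ∃ g, g ∉ A := by
    by_contra! h
    rw [(eq_top_iff' A).2 h, index_top] at hA
    exact hp.out.one_lt.ne hA
  obtain ⟨f, -, hr, hk⟩ := exists_commutator_hom hA hcomm hg
  have h1 : Nat.card f.ker * Nat.card f.range = Nat.card A := by
    rw [← index_ker, card_mul_index]
  rw [hr, hk, Nat.card_congr (subgroupOfEquivOfLe (center_le_of_index hA hcomm hG)).toEquiv] at h1
  have h2 := A.card_mul_index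
  rw [← (commutator G).card_mul_index, hA, ← h1] at h2
  have h3 : 0 < Nat.card (commutator G) := Nat.card_pos
  apply Nat.eq_of_mul_eq_mul_left h3
  rw [← h2]
  ring

theorem conj_pow_of_central {g a c : G} (hc : c ∈ center G) (h : g * a * g⁻¹ = c * a) (k : ℕ) :
    g ^ k * a * (g ^ k)⁻¹ = c ^ k * a := by
  induction k with
  | zero => simp
  | succ k ih =>
    calc g ^ (k + 1) * a * (g ^ (k + 1))⁻¹ = g * (g ^ k * a * (g ^ k)⁻¹) * g⁻¹ := by
          rw [pow_succ']; group
      _ = g * c ^ k * a * g⁻¹ := by rw [ih]; group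
      _ = c ^ k * (g * a * g⁻¹) := by
          rw [mem_center_iff.1 ((center G).pow_mem hc k) g]; group
      _ = c ^ (k + 1) * a := by rw [h, pow_succ]; group

/-- A group of class two with a commutative subgroup of prime index `p` has commutator subgroup of
exponent dividing `p`. -/
theorem pow_eq_one_of_mem_commutator {p : ℕ} [hp : Fact p.Prime] {A : Subgroup G}
    [hAn : A.Normal] (hA : A.index = p) (hcomm : ∀ a ∈ A, ∀ b ∈ A, a * b = b * a) (hclass : commutator G ≤ center G) {c : G}
    (hc : c ∈ commutator G) : c ^ p = 1 := by
  obtain ⟨g, hg⟩ : ∃ g, g ∉ A := by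
    by_contra! h
    rw [(eq_top_iff' A).2 h, index_top] at hA
    exact hp.out.one_lt.ne hA
  obtain ⟨f, hf, hr, -⟩ := exists_commutator_hom hA hcomm hg
  have hcc := hclass hc
  rw [← hr] at hc
  obtain ⟨a, rfl⟩ := hc
  have h1 : g * a * g⁻¹ = f a * a := by rw [hf]; group
  have h2 := conj_pow_of_central hcc h1 p
  -- Conjugation by `g ^ p` multiplies `a` by `f a ^ p`, but it is trivial on `A` because `g ^ p`
  -- lies in the commutative `A`.
  have h3 : g ^ p ∈ A := by
    rw [← QuotientGroup.eq_one_iff, QuotientGroup.mk_pow, ← hA, index_eq_card, pow_card_eq_one']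
  rw [hcomm _ h3 _ a.2, mul_inv_cancel_right] at h2
  exact (mul_eq_right.1 h2.symm)

theorem exists_center_card [Finite G] {p n : ℕ} [hp : Fact p.Prime] (hG : Nat.card G = p ^ n)
    (hn : n ≠ 0) : ∃ k > 0, Nat.card (center G) = p ^ k :=
  IsPGroup.card_center_eq_prime_pow hG (Nat.pos_of_ne_zero hn)

/-- The center of a noncommutative group of order `p ^ n` has order at most `p ^ (n - 2)`. -/
theorem center_card_le [Finite G] {p n k : ℕ} [hp : Fact p.Prime] (hG : Nat.card G = p ^ n)
    (hcomm : ¬ ∀ a b : G, a * b = b * a) (hk : Nat.card (center G) = p ^ k) : k + 2 ≤ n := by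
  by_contra! hlt
  have h1 := (center G).card_mul_index
  rw [hk, hG] at h1
  obtain ⟨m, hm⟩ := (IsPGroup.of_card hG).index (center G)
  rw [hm, ← pow_add] at h1
  have h2 := Nat.pow_right_injective hp.out.two_le h1
  have h3 : IsCyclic (G ⧸ center G) := by
    refine isCyclic_of_card_dvd_prime (p := p) ?_
    rw [← index_eq_card, hm]
    exact (pow_dvd_pow p (by omega : m ≤ 1)).trans (pow_one p).dvd
  exact hcomm (comm_of_isCyclic_quotient le_rfl h3)

end PGroup

end FiniteGroupCharacters

/-! ### Groups with a faithful irreducible representation of dimension p -/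

namespace FiniteGroupCharacters

open Subgroup

universe u

section Faithful

variable {G : Type u} [Group G] [Finite G] {p n : ℕ} [hp : Fact p.Prime]

theorem HasIrr.not_comm_of_prime {G : Type u} [Group G] {N : Subgroup G} (h : HasIrr G N p) :
    ¬ ∀ a b : G, a * b = b * a :=
  fun hc => hp.out.one_lt.ne' (h.dim_eq_one_of_comm hc)

theorem HasIrr.exists_comm_subgroup (hG : IsPGroup p G) (h : HasIrr G ⊥ p) :
    ∃ A : Subgroup G, A.Normal ∧ A.index = p ∧ ∀ a ∈ A, ∀ b ∈ A, a * b = b * a := by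
  obtain ⟨A, hA, hc⟩ := (h.faithful_dim hG h.not_comm_of_prime).2 rfl
  exact ⟨A, normal_of_index_eq_prime hG A hA, hA, hc⟩

theorem HasIrr.index_commutator (hG : IsPGroup p G) (h : HasIrr G ⊥ p) :
    (commutator G).index = p * Nat.card (center G) := by
  obtain ⟨A, _, hA, hc⟩ := h.exists_comm_subgroup hG
  exact FiniteGroupCharacters.index_commutator hA hc h.not_comm_of_prime

/-- In a `p`-group with a commutative subgroup of index `p`, the irreducible representations have
dimension `1` or `p`. -/
theorem HasIrr.dim_eq (hG : IsPGroup p G) {A : Subgroup G} (hA : A.index = p)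
    (hc : ∀ a ∈ A, ∀ b ∈ A, a * b = b * a) {N : Subgroup G} {d : ℕ} (h : HasIrr G N d) :
    d = 1 ∨ d = p := by
  by_cases hN : commutator G ≤ N
  · exact Or.inl (h.dim_eq_one_of_commutator_le hN)
  · right
    have := h.normal
    have h' := h.quotient_map N le_rfl
    rw [QuotientGroup.map_mk'_self] at h'
    exact le_antisymm (hA ▸ h.le_index A hc)
      (h'.faithful_dim (hG.to_quotient N) fun hc => hN (commutator_le_of_comm_quotient hc)).1

theorem card_of_index_eq {G : Type u} [Group G] (hG : Nat.card G = p ^ n) {N : Subgroup G} {i : ℕ} (hi : i ≤ n)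
    (hN : N.index = p ^ i) : Nat.card N = p ^ (n - i) := by
  have h := N.card_mul_index
  rw [hN, hG] at h
  apply Nat.eq_of_mul_eq_mul_right (pow_pos hp.out.pos i)
  rw [h, ← pow_add, Nat.sub_add_cancel hi]

theorem nilpotencyClass_eq_succ (hG : IsPGroup p G) [Nontrivial G] :
    Group.nilpotencyClass G = Group.nilpotencyClass (G ⧸ center G) + 1 := by
  have := hG.isNilpotent
  exact Group.nilpotencyClass_eq_quotient_center_plus_one

theorem nilpotencyClass_le_one_of_comm {G : Type u} [Group G] (h : ∀ a b : G, a * b = b * a) :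
    Group.nilpotencyClass G ≤ 1 := by
  let : CommGroup G := { ‹Group G› with mul_comm := h }
  exact CommGroup.nilpotencyClass_le_one

theorem commutator_le_center_iff (hG : IsPGroup p G) :
    commutator G ≤ center G ↔ Group.nilpotencyClass G ≤ 2 := by
  have hn := hG.isNilpotent
  rcases subsingleton_or_nontrivial G with h | h
  · rw [Group.nilpotencyClass_zero_iff_subsingleton.2 h]
    exact ⟨fun _ => by omega, fun _ x _ => by rw [Subsingleton.elim x 1]; exact one_mem _⟩
  · rw [nilpotencyClass_eq_succ hG]
    constructor
    · intro hle
      have := nilpotencyClass_le_one_of_comm (mk_commute_of_commutator_le hle)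
      omega
    · intro hle
      have h1 : Group.nilpotencyClass (G ⧸ center G) ≤ 1 := by omega
      rw [Group.IsNilpotent.nilpotencyClass_le_one_iff] at h1
      exact commutator_le_of_comm_quotient h1.is_comm.comm

theorem nilpotencyClass_eq_two (hG : IsPGroup p G) (hc : ¬ ∀ a b : G, a * b = b * a)
    (hle : commutator G ≤ center G) : Group.nilpotencyClass G = 2 := by
  have hn := hG.isNilpotent
  refine le_antisymm ((commutator_le_center_iff hG).1 hle) ?_
  by_contra! hlt
  exact hc ((Group.IsNilpotent.nilpotencyClass_le_one_iff.1 (Nat.le_of_lt_succ hlt)).is_comm.comm)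

/-- If a noncommutative `p`-group has a cyclic quotient by a normal subgroup of order `p ^ 2`, then
its commutator subgroup has order `p`. -/
theorem card_commutator_of_isCyclic_quotient (hG : IsPGroup p G)
    (hc : ¬ ∀ a b : G, a * b = b * a) (K : Subgroup G) [K.Normal] (hK : Nat.card K = p ^ 2)
    (hcyc : IsCyclic (G ⧸ K)) : Nat.card (commutator G) = p := by
  have := hG.isNilpotent
  have hle : commutator G ≤ K := commutator_le_of_comm_quotient fun a b => by
    let := IsCyclic.commGroup (α := G ⧸ K)
    exact mul_comm a b
  obtain ⟨k, hk, hk'⟩ := (Nat.dvd_prime_pow hp.out).1 (hK ▸ card_dvd_of_le hle)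
  interval_cases k
  · rw [pow_zero] at hk'
    exact absurd (commutator_eq_bot_iff_comm.1 (eq_bot_of_card_eq _ hk')) hc
  · rwa [pow_one] at hk'
  -- If $|G'|=p^2$, the cyclic quotient is the abelianization itself.
  · have : commutator G = K := eq_of_le_of_card_ge hle (by rw [hk', hK])
    subst this
    exact absurd (comm_of_isCyclic_abelianization hcyc) hc

theorem class_and_center_of_card_cube (hG : Nat.card G = p ^ 3)
    (hc : ¬ ∀ a b : G, a * b = b * a) :
    Group.nilpotencyClass G = 2 ∧ Nat.card (center G) = p := by
  obtain ⟨k, hk0, hk⟩ := exists_center_card hG (by norm_num)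
  have := center_card_le hG hc hk
  obtain rfl : k = 1 := by omega
  rw [pow_one] at hk
  refine ⟨nilpotencyClass_eq_two (IsPGroup.of_card hG) hc ?_, hk⟩
  apply commutator_le_of_comm_quotient
  have h2 : Nat.card (G ⧸ center G) = p ^ 2 := by
    have h := (center G).card_mul_index
    rw [hk, hG, index_eq_card] at h
    apply Nat.eq_of_mul_eq_mul_left hp.out.pos
    rw [h]; ring
  exact (IsPGroup.isMulCommutative_of_card_eq_prime_sq h2).is_comm.comm

end Faithful

theorem map_mk_commutator {G : Type*} [Group G] (N : Subgroup G) [N.Normal] :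
    (commutator G).map (QuotientGroup.mk' N) = commutator (G ⧸ N) := by
  rw [commutator_def, commutator_def, Subgroup.map_commutator,
    map_top_of_surjective _ (QuotientGroup.mk'_surjective N)]

/-- A group of order `p ^ n` with a faithful irreducible character of degree `p` and with
characters of codegrees `p, …, p ^ (n - 2)` has maximal class, or has commutator subgroup of order
`p` and a cyclic quotient of order `p ^ (n - 2)`. -/
theorem maximalClass_or_card_commutator {p : ℕ} [hp : Fact p.Prime] (n : ℕ) (hn : 3 ≤ n) :
    ∀ (G : Type u) [Group G] [Finite G], Nat.card G = p ^ n → HasIrr G ⊥ p →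
    (∀ i, 1 ≤ i → i + 2 ≤ n → ∃ N d, HasIrr G N d ∧ N.index = p ^ i * d) →
    (Group.nilpotencyClass G = n - 1 ∧ Nat.card (center G) = p) ∨
    (4 ≤ n ∧ Nat.card (commutator G) = p ∧
      ∃ (N : Subgroup G) (_ : N.Normal), IsCyclic (G ⧸ N) ∧ N.index = p ^ (n - 2)) := by
  induction n, hn using Nat.le_induction with
  | base =>
    intro G _ _ hG hf _
    exact Or.inl (class_and_center_of_card_cube hG hf.not_comm_of_prime)
  | succ n hn ih =>
    intro G _ _ hG hf hcod
    have hpG := IsPGroup.of_card hG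
    have hnc := hf.not_comm_of_prime
    have hp1 := hp.out.one_lt
    obtain ⟨A, hAn, hA, hAc⟩ := hf.exists_comm_subgroup hpG
    have hcyc := hf.isCyclic_center
    -- The group now has order `p ^ (n + 1)`, so this is the largest codegree that `hcod` provides.
    obtain ⟨N, d, hN, hNi⟩ := hcod (n - 1) (by omega) (by omega)
    have hNn := hN.normal
    rcases hN.dim_eq hpG hA hAc with rfl | hd
    · right
      rw [mul_one] at hNi
      have hNc := card_of_index_eq hG (by omega) hNi
      rw [show n + 1 - (n - 1) = 2 by omega] at hNc
      exact ⟨by omega, card_commutator_of_isCyclic_quotient hpG hnc N hNc hN.isCyclic_quotient,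
        N, hNn, hN.isCyclic_quotient, by rw [hNi]; congr 1⟩
    -- From here on the prime is called `d`.
    subst hd
    rw [← pow_succ, Nat.sub_add_cancel (by omega : 1 ≤ n)] at hNi
    have hNc := card_of_index_eq hG (by omega) hNi
    rw [Nat.add_sub_cancel_left, pow_one] at hNc
    have hle : ∀ M : Subgroup G, M.Normal → M ≠ ⊥ → N ≤ M := fun M _ hM =>
      le_of_isCyclic_center hpG N hNc M hM
    have hquot := hN.quotient_map N le_rfl
    rw [QuotientGroup.map_mk'_self] at hquot
    have hGN : Nat.card (G ⧸ N) = d ^ n := by rw [← index_eq_card, hNi]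
    have hpGN := IsPGroup.of_card hGN
    have hcomm_ne : commutator G ≠ ⊥ := fun h => hnc (commutator_eq_bot_iff_comm.1 h)
    have hN_comm : N ≤ commutator G := hle _ inferInstance hcomm_ne
    have hN_center : N ≤ center G := le_center_of_card_eq_prime hpG N hNc
    have hindex : (commutator (G ⧸ N)).index = (commutator G).index := by
      rw [← map_mk_commutator, index_map_eq _ (QuotientGroup.mk'_surjective N)]
      rwa [QuotientGroup.ker_mk']
    -- Both groups satisfy $|G:G'|=p|Z(G)|$, and passing to `G ⧸ N` does not change the index of the
    -- commutator subgroup.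
    have hZ : Nat.card (center (G ⧸ N)) = Nat.card (center G) := by
      apply Nat.eq_of_mul_eq_mul_left hp.out.pos
      rw [← hquot.index_commutator hpGN, ← hf.index_commutator hpG, hindex]
    rcases ih (G ⧸ N) hGN hquot (fun i hi hin => by
      obtain ⟨M, e, hM, hMi⟩ := hcod i hi (by omega)
      have hMn := hM.normal
      have hMN : N ≤ M := by
        -- A faithful representation has dimension at most the prime, so its codegree is at least `d
        -- ^ n`, too large for these `i`.
        refine hle M hMn ?_
        rintro rfl
        rw [index_bot, hG] at hMi
        have : e ≤ d := hA ▸ hM.le_index A hAc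
        have h1 : d ^ (n + 1) ≤ d ^ (i + 1) := by
          rw [hMi, pow_succ d i]
          exact Nat.mul_le_mul_left _ this
        have := (Nat.pow_le_pow_iff_right hp1).1 h1
        omega
      refine ⟨_, e, hM.quotient_map N hMN, ?_⟩
      rw [index_map_eq _ (QuotientGroup.mk'_surjective N) (by rwa [QuotientGroup.ker_mk'])]
      exact hMi) with ⟨hclass, hcard⟩ | ⟨hn4, hcard, -⟩
    · left
      have hcard' : Nat.card (center G) = d := by rw [← hZ, hcard]
      have hNZ : N = center G := eq_of_le_of_card_ge hN_center (by rw [hcard', hNc])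
      subst hNZ
      have : Nontrivial G := (Subgroup.nontrivial_iff_ne_bot _).2 hcomm_ne |>.exists_pair_ne.elim
        fun a ⟨b, h⟩ => ⟨a, b, fun e => h (Subtype.ext e)⟩
      refine ⟨?_, hcard'⟩
      rw [nilpotencyClass_eq_succ hpG, hclass]
      omega
    · exfalso
      have hcycN := hquot.isCyclic_center
      have hind : (commutator (G ⧸ N)).index = d ^ (n - 1) := by
        have := (commutator (G ⧸ N)).card_mul_index
        rw [hcard, hGN] at this
        apply Nat.eq_of_mul_eq_mul_left hp.out.pos
        rw [this, ← pow_succ', Nat.sub_add_cancel (by omega : 1 ≤ n)]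
      have hcardZ : Nat.card (center G) = d ^ (n - 2) := by
        have := hf.index_commutator hpG
        rw [← hindex, hind] at this
        apply Nat.eq_of_mul_eq_mul_left hp.out.pos
        rw [← this, ← pow_succ']
        congr 1
        omega
      have hcc : Nat.card (commutator G) = d ^ 2 := by
        have := card_of_index_eq hG (N := commutator G) (i := n - 1) (by omega)
          (by rw [← hindex, hind])
        rwa [show n + 1 - (n - 1) = 2 by omega] at this
      have hle2 : commutator G ≤ center G := by
        -- The image of $Z(G)$ is a nontrivial normal subgroup of `G ⧸ N`, whose center is cyclic,
        -- so it contains the commutator subgroup of order `d`; hence $G'\le Z(G)$.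
        have hne : (center G).map (QuotientGroup.mk' N) ≠ ⊥ := by
          intro h
          rw [Subgroup.map_eq_bot_iff, QuotientGroup.ker_mk'] at h
          have := card_le_of_le h
          rw [hcardZ, hNc] at this
          have := (Nat.pow_le_pow_iff_right hp1).1 (this.trans (pow_one d).ge)
          omega
        have hnorm : ((center G).map (QuotientGroup.mk' N)).Normal :=
          Subgroup.Normal.map inferInstance _ (QuotientGroup.mk'_surjective N)
        have h := le_of_isCyclic_center hpGN (commutator (G ⧸ N)) hcard _ hne
        rw [← map_mk_commutator, map_le_iff_le_comap, comap_map_eq, QuotientGroup.ker_mk',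
          sup_eq_left.2 hN_center] at h
        exact h
      have hcycc : IsCyclic (commutator G) :=
        isCyclic_of_injective (Subgroup.inclusion hle2) (Subgroup.inclusion_injective hle2)
      obtain ⟨c, hco⟩ := IsCyclic.exists_ofOrder_eq_natCard (α := commutator G)
      have h1 := orderOf_dvd_of_pow_eq_one (x := c) (n := d)
        (Subtype.ext (pow_eq_one_of_mem_commutator hA hAc hle2 c.2))
      rw [hco, hcc] at h1
      have := Nat.le_of_dvd hp.out.pos h1
      nlinarith

end FiniteGroupCharacters

/-! ### Splitting over a cyclic subgroup of index p -/

namespace FiniteGroupCharacters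

open Subgroup

universe u

section Structure

variable {G : Type u} [Group G] [Finite G] {p n : ℕ} [hp : Fact p.Prime]

theorem comm_of_isCyclic {G : Type u} [Group G] (h : IsCyclic G) (a b : G) : a * b = b * a := by
  let := IsCyclic.commGroup (α := G)
  exact mul_comm a b

theorem exists_zmod_mulEquiv {G : Type*} [Group G] (H : Subgroup G) {m : ℕ} (hH : IsCyclic H)
    (hm : Nat.card H = m) : Nonempty (H ≃* Multiplicative (ZMod m)) := by
  subst hm
  exact ⟨(zmodCyclicMulEquiv hH).symm⟩

theorem nonempty_mulEquiv_prod {G : Type*} [Group G] (hc : ∀ a b : G, a * b = b * a)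
    {H K : Subgroup G} (h : H.IsComplement' K) (hH : IsCyclic H) (hK : IsCyclic K) {a b : ℕ}
    (ha : Nat.card H = a) (hb : Nat.card K = b) :
    Nonempty (G ≃* Multiplicative (ZMod a) × Multiplicative (ZMod b)) := by
  obtain ⟨e⟩ := exists_zmod_mulEquiv H hH ha
  obtain ⟨e'⟩ := exists_zmod_mulEquiv K hK hb
  let f : H × K →* G := MonoidHom.noncommCoprod H.subtype K.subtype (fun a b => hc a b)
  exact ⟨(MulEquiv.ofBijective f h).symm.trans (MulEquiv.prodCongr e e')⟩

theorem exists_mulEquiv_semidirectProduct {G : Type*} [Group G] {H K : Subgroup G} [H.Normal]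
    (h : H.IsComplement' K) (hH : IsCyclic H) (hK : IsCyclic K) {a b : ℕ}
    (ha : Nat.card H = a) (hb : Nat.card K = b) :
    ∃ φ : Multiplicative (ZMod b) →* MulAut (Multiplicative (ZMod a)),
      Nonempty (G ≃* Multiplicative (ZMod a) ⋊[φ] Multiplicative (ZMod b)) := by
  obtain ⟨e⟩ := exists_zmod_mulEquiv H hH ha
  obtain ⟨e'⟩ := exists_zmod_mulEquiv K hK hb
  exact ⟨_, ⟨(SemidirectProduct.mulEquivSubgroup h).symm.trans (SemidirectProduct.congr' e e')⟩⟩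

theorem orderOf_eq_pow {G : Type u} [Group G] (hG : Nat.card G = p ^ n) (x : G) : ∃ j ≤ n, orderOf x = p ^ j :=
  (Nat.dvd_prime_pow hp.out).1 (hG ▸ orderOf_dvd_natCard x)

/-- A noncyclic commutative group of order `p ^ n` with a cyclic quotient of order `p ^ (n - 1)` is
a product of cyclic groups. -/
theorem nonempty_mulEquiv_prod_of_isCyclic_quotient (hn : 1 ≤ n) (hG : Nat.card G = p ^ n)
    (hc : ∀ a b : G, a * b = b * a) (hncyc : ¬ IsCyclic G) (N : Subgroup G) [N.Normal]
    (hN : N.index = p ^ (n - 1)) (hcyc : IsCyclic (G ⧸ N)) :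
    Nonempty (G ≃* Multiplicative (ZMod (p ^ (n - 1))) × Multiplicative (ZMod p)) := by
  have hNc : Nat.card N = p := by
    have := card_of_index_eq hG (by omega) hN
    rwa [show n - (n - 1) = 1 by omega, pow_one] at this
  obtain ⟨q, hq⟩ := IsCyclic.exists_ofOrder_eq_natCard (α := G ⧸ N)
  rw [← index_eq_card, hN] at hq
  obtain ⟨x, rfl⟩ := QuotientGroup.mk_surjective q
  have hdvd : p ^ (n - 1) ∣ orderOf x := hq ▸ orderOf_map_dvd (QuotientGroup.mk' N) x
  obtain ⟨j, hj, hxj⟩ := orderOf_eq_pow hG x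
  have hx : orderOf x = p ^ (n - 1) := by
    have h1 : n - 1 ≤ j := (Nat.pow_dvd_pow_iff_le_right hp.out.one_lt).1 (hxj ▸ hdvd)
    have h2 : j ≠ n := fun h => hncyc (isCyclic_of_orderOf_eq_card x (by rw [hxj, h, hG]))
    rw [hxj, show j = n - 1 by omega]
  have hcard : Nat.card (zpowers x) = p ^ (n - 1) := by rw [Nat.card_zpowers, hx]
  refine nonempty_mulEquiv_prod hc (H := zpowers x) (K := N)
    (isComplement'_of_card_mul_and_disjoint ?_ ?_) inferInstance
    (isCyclic_of_prime_card hNc) hcard hNc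
  · rw [hcard, hNc, hG, ← pow_succ, Nat.sub_add_cancel hn]
  -- `x` and its image modulo `N` have the same order, so no nontrivial power of `x` lies in `N`.
  · rw [disjoint_def]
    rintro _ ⟨k, rfl⟩ hk
    have h1 : (x : G ⧸ N) ^ k = 1 := by
      rw [← QuotientGroup.mk_zpow]
      exact (QuotientGroup.eq_one_iff _).2 hk
    rw [← orderOf_dvd_iff_zpow_eq_one, hq, ← hx, orderOf_dvd_iff_zpow_eq_one] at h1
    exact h1

/-- Collecting the factors `a` to the left moves them past `0 + 1 + ⋯ + (k - 1)` factors `b`, each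
at the cost of one central `c`. -/
theorem mul_pow_of_central {G : Type*} [Group G] {a b c : G} (hc : c ∈ center G)
    (h : b * a = c * (a * b)) (k : ℕ) : (a * b) ^ k = c ^ (k.choose 2) * (a ^ k * b ^ k) := by
  have hcc : ∀ (i : ℕ) (g : G), g * c ^ i = c ^ i * g := fun i g =>
    mem_center_iff.1 ((center G).pow_mem hc i) g
  have hb : ∀ k : ℕ, b ^ k * a = c ^ k * (a * b ^ k) := by
    intro k
    induction k with
    | zero => simp
    | succ k ih =>
      calc b ^ (k + 1) * a = b ^ k * (b * a) := by rw [pow_succ, mul_assoc]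
        _ = b ^ k * c ^ 1 * a * b := by rw [h]; group
        _ = c * (b ^ k * a) * b := by rw [hcc]; group
        _ = c ^ (k + 1) * (a * b ^ (k + 1)) := by
          rw [ih, pow_succ' c, pow_succ b]; group
  induction k with
  | zero => simp
  | succ k ih =>
    calc (a * b) ^ (k + 1) = c ^ (k.choose 2) * (a ^ k * (b ^ k * a) * b) := by
          rw [pow_succ, ih]; group
      _ = c ^ (k.choose 2) * ((a ^ k * c ^ k) * (a * b ^ k) * b) := by rw [hb]; group
      _ = c ^ (k.choose 2) * c ^ k * (a ^ (k + 1) * b ^ (k + 1)) := by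
          rw [hcc, pow_succ a, pow_succ b]; group
      _ = c ^ ((k + 1).choose 2) * (a ^ (k + 1) * b ^ (k + 1)) := by
          have hk : (k + 1).choose 2 = k.choose 2 + k := by
            rw [Nat.choose_succ_succ' k 1, Nat.choose_one_right, add_comm]
          rw [hk, pow_add c]

/-- $gy^pg^{-1}=([g,y]\,y)^p=[g,y]^py^p=y^p$, as $[g,y]$ is central of order dividing $p$. -/
theorem pow_mem_center_of_card_commutator {G : Type*} [Group G] {p : ℕ}
    (hle : commutator G ≤ center G) (hc : Nat.card (commutator G) = p) (y : G) :
    y ^ p ∈ center G := by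
  rw [mem_center_iff]
  intro g
  have hmem : g * y * g⁻¹ * y⁻¹ ∈ commutator G := by
    rw [commutator_def]
    exact commutator_mem_commutator (mem_top _) (mem_top _)
  have h1 : (g * y * g⁻¹ * y⁻¹) ^ p = 1 := by
    have : (⟨_, hmem⟩ : commutator G) ^ p = 1 := by rw [← hc, pow_card_eq_one']
    exact congrArg Subtype.val this
  have h2 : g * y * g⁻¹ = (g * y * g⁻¹ * y⁻¹) * y := by group
  have hcm : Commute (g * y * g⁻¹ * y⁻¹) y := (mem_center_iff.1 (hle hmem) y).symm
  have h3 : (g * y * g⁻¹) ^ p = y ^ p := by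
    rw [h2, hcm.mul_pow, h1, one_mul]
  rw [conj_pow] at h3
  exact mul_inv_eq_iff_eq_mul.1 h3

/-- Let `x` lift a generator of `G ⧸ N`. As `x ^ p` is central and nontrivial and the center is
cyclic, its powers contain $G'$. Order `p ^ n` would make `G` cyclic; order `p ^ (n - 2)` would make
$\langle x\rangle$ meet `N` trivially, although both contain $G'\ne1$. -/
theorem exists_orderOf_eq (hn : 4 ≤ n) (hG : Nat.card G = p ^ n)
    (hnc : ¬ ∀ a b : G, a * b = b * a) (hZ : IsCyclic (center G))
    (hcard : Nat.card (commutator G) = p) (N : Subgroup G) [N.Normal]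
    (hN : N.index = p ^ (n - 2)) (hcyc : IsCyclic (G ⧸ N)) :
    ∃ x : G, orderOf x = p ^ (n - 1) ∧ commutator G ≤ zpowers (x ^ p) := by
  have hpG := IsPGroup.of_card hG
  have hp1 := hp.out.one_lt
  have hle := le_center_of_card_eq_prime hpG _ hcard
  obtain ⟨q, hq⟩ := IsCyclic.exists_ofOrder_eq_natCard (α := G ⧸ N)
  rw [← index_eq_card, hN] at hq
  obtain ⟨x, rfl⟩ := QuotientGroup.mk_surjective q
  have hdvd : p ^ (n - 2) ∣ orderOf x := hq ▸ orderOf_map_dvd (QuotientGroup.mk' N) x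
  have hxc := pow_mem_center_of_card_commutator hle hcard x
  have hnorm : (zpowers (x ^ p)).Normal := by
    refine ⟨fun y hy g => ?_⟩
    have : y ∈ center G := (zpowers_le.2 hxc) hy
    rwa [mem_center_iff.1 this g, mul_inv_cancel_right]
  have hne : zpowers (x ^ p) ≠ ⊥ := by
    rw [Ne, zpowers_eq_bot, ← orderOf_dvd_iff_pow_eq_one]
    intro h
    have := (Nat.pow_dvd_pow_iff_le_right hp1).1 ((hdvd.trans h).trans (pow_one p).symm.dvd)
    omega
  have hsub : commutator G ≤ zpowers (x ^ p) := le_of_isCyclic_center hpG _ hcard _ hne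
  refine ⟨x, ?_, hsub⟩
  obtain ⟨j, hj, hxj⟩ := orderOf_eq_pow hG x
  have h1 : n - 2 ≤ j := (Nat.pow_dvd_pow_iff_le_right hp1).1 (hxj ▸ hdvd)
  have h2 : j ≠ n := fun h =>
    hnc (comm_of_isCyclic (isCyclic_of_orderOf_eq_card x (by rw [hxj, h, hG])))
  have h3 : j ≠ n - 2 := by
    rintro rfl
    apply hnc
    rw [← commutator_eq_bot_iff_comm, eq_bot_iff]
    intro c hc
    have hcN : c ∈ N := commutator_le_of_comm_quotient (comm_of_isCyclic hcyc) hc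
    obtain ⟨k, rfl⟩ := hsub hc
    have h4 : (x : G ⧸ N) ^ ((p : ℤ) * k) = 1 := by
      rw [zpow_mul, zpow_natCast]
      exact (QuotientGroup.eq_one_iff _).2 hcN
    rw [← orderOf_dvd_iff_zpow_eq_one, hq, ← hxj, orderOf_dvd_iff_zpow_eq_one, zpow_mul,
      zpow_natCast] at h4
    exact h4
  rw [hxj, show j = n - 1 by omega]

/-- A noncommutative group of order `p ^ n`, `n ≥ 4`, with an element `x` of order `p ^ (n - 1)`
such that the commutator subgroup is central and has order `p`, splits over `⟨x⟩`. -/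
theorem exists_mulEquiv_semidirectProduct_of_orderOf (hn : 4 ≤ n) (hG : Nat.card G = p ^ n)
    (hnc : ¬ ∀ a b : G, a * b = b * a) (hcard : Nat.card (commutator G) = p) {x : G}
    (hx : orderOf x = p ^ (n - 1)) (hsub : commutator G ≤ zpowers (x ^ p)) :
    ∃ φ : Multiplicative (ZMod p) →* MulAut (Multiplicative (ZMod (p ^ (n - 1)))),
      Nonempty (G ≃* Multiplicative (ZMod (p ^ (n - 1))) ⋊[φ] Multiplicative (ZMod p)) := by
  have hpG := IsPGroup.of_card hG
  have hp0 : (p : ℤ) ≠ 0 := by exact_mod_cast hp.out.ne_zero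
  have hle := le_center_of_card_eq_prime hpG _ hcard
  have hHc : Nat.card (zpowers x) = p ^ (n - 1) := by rw [Nat.card_zpowers, hx]
  have hHi : (zpowers x).index = p := by
    have := (zpowers x).card_mul_index
    rw [hHc, hG] at this
    apply Nat.eq_of_mul_eq_mul_left (pow_pos hp.out.pos (n - 1))
    rw [this, ← pow_succ, Nat.sub_add_cancel (by omega)]
  have hHn : (zpowers x).Normal := normal_of_index_eq_prime hpG _ hHi
  obtain ⟨y, hy⟩ : ∃ y, y ∉ zpowers x := by
    by_contra! h
    rw [(eq_top_iff' _).2 h, index_top] at hHi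
    exact hp.out.one_lt.ne hHi
  have hord : ∀ m : ℤ, x ^ m = 1 ↔ (p : ℤ) ^ (n - 1) ∣ m := fun m => by
    rw [← orderOf_dvd_iff_zpow_eq_one, hx]
    push_cast
    rfl
  -- If `y ^ p = x ^ m` with `m` prime to `p`, then `x` is a power of the central element `y ^ p`,
  -- and `G` is commutative.
  obtain ⟨k, hk⟩ : ∃ k : ℤ, x ^ ((p : ℤ) * k) = y ^ p := by
    have hyH : y ^ p ∈ zpowers x := by
      rw [← QuotientGroup.eq_one_iff, QuotientGroup.mk_pow]
      conv_lhs => rw [← hHi, index_eq_card, pow_card_eq_one']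
    obtain ⟨m, hm⟩ := hyH
    have hm' : x ^ m = y ^ p := hm
    by_cases hpm : (p : ℤ) ∣ m
    · obtain ⟨k, rfl⟩ := hpm
      exact ⟨k, hm'⟩
    · exfalso
      have hcop : IsCoprime m ((p : ℤ) ^ (n - 1)) :=
        (((Nat.prime_iff_prime_int.1 hp.out).coprime_iff_not_dvd.2 hpm).symm).pow_right
      obtain ⟨s, t, hst⟩ := hcop
      have hxc : x ∈ center G := by
        have : x = (x ^ m) ^ s := by
          rw [← zpow_mul, mul_comm m s, eq_sub_of_add_eq hst, zpow_sub, zpow_one,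
            (hord _).2 (Dvd.intro_left t rfl), inv_one, mul_one]
        rw [this, hm']
        exact (center G).zpow_mem (pow_mem_center_of_card_commutator hle hcard y) s
      have hcyc : IsCyclic (G ⧸ zpowers x) := isCyclic_of_prime_card (p := p) hHi
      exact hnc (comm_of_isCyclic_quotient (zpowers_le.2 hxc) hcyc)
  have hcmem : x * y * x⁻¹ * y⁻¹ ∈ commutator G := by
    rw [commutator_def]
    exact commutator_mem_commutator (mem_top _) (mem_top _)
  obtain ⟨s, hs⟩ := hsub hcmem
  have hs' : x ^ ((p : ℤ) * s) = x * y * x⁻¹ * y⁻¹ := by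
    rw [zpow_mul, zpow_natCast]
    exact hs
  -- `x ^ (p * s)` has order dividing `p`, so `p ^ (n - 3)` divides `s`; this is where `4 ≤ n`
  -- enters.
  have hps : (p : ℤ) ∣ s := by
    have h1 : (x * y * x⁻¹ * y⁻¹) ^ p = 1 := by
      have : (⟨_, hcmem⟩ : commutator G) ^ p = 1 := by rw [← hcard, pow_card_eq_one']
      exact congrArg Subtype.val this
    rw [← hs', ← zpow_natCast, ← zpow_mul, hord, show n - 1 = (n - 4) + 1 + 2 by omega, pow_add,
      show (p : ℤ) * s * p = s * (p : ℤ) ^ 2 by ring] at h1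
    have h2 := Int.dvd_of_mul_dvd_mul_right (pow_ne_zero 2 hp0) h1
    exact (Dvd.intro_left _ (pow_succ _ _).symm).trans h2
  obtain ⟨u, v, huv⟩ : IsCoprime (1 + s * (p.choose 2 : ℤ)) ((p : ℤ) ^ (n - 2)) := by
    apply IsCoprime.pow_right
    obtain ⟨r, rfl⟩ := hps
    exact ⟨1, -(r * (p.choose 2 : ℤ)), by ring⟩
  have hxy : ∀ j : ℤ, x ^ j * y = (x * y * x⁻¹ * y⁻¹) ^ j * (y * x ^ j) := by
    intro j
    have hcm : Commute (x * y * x⁻¹ * y⁻¹)⁻¹ x :=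
      (mem_center_iff.1 ((center G).inv_mem (hle hcmem)) x).symm
    have h1 : y * x * y⁻¹ = (x * y * x⁻¹ * y⁻¹)⁻¹ * x := by group
    have h2 : y * x ^ j * y⁻¹ = ((x * y * x⁻¹ * y⁻¹)⁻¹) ^ j * x ^ j := by
      rw [← conj_zpow, h1, hcm.mul_zpow]
    rw [inv_zpow] at h2
    rw [mul_inv_eq_iff_eq_mul.1 h2]
    group
  -- By the collection formula, `(y * x ^ j) ^ p` is `x` to the power `p * (k + j * (1 + s *
  -- p.choose 2))`. Since `u` inverts the last factor modulo `p ^ (n - 2)`, this `j` makes the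
  -- exponent divisible by `p ^ (n - 1)`.
  let j : ℤ := -(k * u)
  have hyj : (y * x ^ j) ^ p = 1 := by
    rw [mul_pow_of_central ((center G).zpow_mem (hle hcmem) j) (hxy j) p, ← hs', ← hk,
      ← zpow_natCast, ← zpow_natCast, ← zpow_mul, ← zpow_mul, ← zpow_mul, ← zpow_add, ← zpow_add,
      hord]
    refine ⟨k * v, ?_⟩
    have : (p : ℤ) ^ (n - 1) = p * (p : ℤ) ^ (n - 2) := by
      rw [← pow_succ']; congr 1; omega
    rw [this]
    have h3 : v * (p : ℤ) ^ (n - 2) = 1 - u * (1 + s * (p.choose 2 : ℤ)) := by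
      linear_combination huv
    calc _ = (p : ℤ) * k * (1 - u * (1 + s * (p.choose 2 : ℤ))) := by
          simp only [j]; ring
      _ = _ := by rw [← h3]; ring
  have hyH : y * x ^ j ∉ zpowers x := fun h =>
    hy (((zpowers x).mul_mem_cancel_right (zpow_mem (mem_zpowers x) j)).1 h)
  have hyo : orderOf (y * x ^ j) = p :=
    orderOf_eq_prime hyj fun h => hyH (h ▸ one_mem _)
  have hKc : Nat.card (zpowers (y * x ^ j)) = p := by rw [Nat.card_zpowers, hyo]
  refine exists_mulEquiv_semidirectProduct (H := zpowers x) (K := zpowers (y * x ^ j))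
    (isComplement'_of_card_mul_and_disjoint ?_ ?_) inferInstance inferInstance hHc hKc
  · rw [hHc, hKc, hG, ← pow_succ, Nat.sub_add_cancel (by omega)]
  · rw [disjoint_iff]
    have hdvd : Nat.card (zpowers x ⊓ zpowers (y * x ^ j) : Subgroup G) ∣ p :=
      hKc ▸ card_dvd_of_le inf_le_right
    rcases (Nat.dvd_prime hp.out).1 hdvd with h | h
    · exact eq_bot_of_card_eq _ h
    · have := eq_of_le_of_card_ge
        (inf_le_right : zpowers x ⊓ zpowers (y * x ^ j) ≤ zpowers (y * x ^ j)) (by rw [h, hKc])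
      exact absurd (zpowers_le.1 (inf_eq_right.1 this)) hyH

end Structure

end FiniteGroupCharacters

/-! ### Realising and bounding codegrees -/

namespace FiniteGroupCharacters

open Subgroup

universe u

section Codegree

variable {G : Type u} [Group G] [Finite G] {p n : ℕ} [hp : Fact p.Prime]

theorem pow_mem_cod {p : ℕ} {N : Subgroup G} {d i : ℕ} (h : HasIrr G N d) (hi : N.index = p ^ i * d) :
    (p : ℂ) ^ i ∈ cod G := by
  rw [mem_cod_iff]
  refine ⟨N, d, h, ?_⟩
  have : (d : ℂ) ≠ 0 := by exact_mod_cast h.pos.ne'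
  rw [hi, eq_div_iff this]
  push_cast
  rfl

theorem exists_of_pow_mem_cod {p : ℕ} {i : ℕ} (h : (p : ℂ) ^ i ∈ cod G) :
    ∃ N d, HasIrr G N d ∧ N.index = p ^ i * d := by
  rw [mem_cod_iff] at h
  obtain ⟨N, d, hN, hi⟩ := h
  refine ⟨N, d, hN, ?_⟩
  have : (d : ℂ) ≠ 0 := by exact_mod_cast hN.pos.ne'
  rw [eq_div_iff this] at hi
  exact_mod_cast hi.symm

/-- A finite commutative group has, for each element `q`, a linear character with image of order
`orderOf q`. -/
theorem exists_hom_index_ker (H : Type*) [CommGroup H] [Finite H] (q : H) :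
    ∃ f : H →* ℂˣ, f.ker.index = orderOf q := by
  have : NeZero (Monoid.exponent H : ℂ) :=
    ⟨by exact_mod_cast (Monoid.exponent_ne_zero_of_finite (G := H))⟩
  -- `H` is isomorphic to its dual; the character matching `q` has the order of `q`, which is the
  -- size of its cyclic image.
  obtain ⟨e⟩ := CommGroup.monoidHom_mulEquiv_of_hasEnoughRootsOfUnity H ℂ
  refine ⟨e.symm q, ?_⟩
  rw [← orderOf_injective e.symm.toMonoidHom e.symm.injective q]
  set f := e.symm q with hf
  change f.ker.index = orderOf f
  have hfin : Finite f.range := Set.finite_range f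
  have hcyc : IsCyclic f.range := inferInstance
  obtain ⟨⟨_, h, rfl⟩, hr⟩ := IsCyclic.exists_ofOrder_eq_natCard (α := f.range)
  have hr' : orderOf (f h) = Nat.card f.range := (orderOf_mk _ _).symm.trans hr
  rw [index_ker]
  refine Nat.dvd_antisymm ?_ ?_
  · rw [← hr']
    exact orderOf_dvd_of_pow_eq_one (by rw [← MonoidHom.pow_apply, pow_orderOf_eq_one]; rfl)
  · refine orderOf_dvd_of_pow_eq_one (MonoidHom.ext fun x => ?_)
    have : (⟨f x, x, rfl⟩ : f.range) ^ Nat.card f.range = 1 := pow_card_eq_one'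
    exact congrArg Subtype.val this

/-- A power of `q` has order `p ^ i`; the linear character attached to it, pulled back along `π`,
has codegree equal to the index of its kernel. -/
theorem pow_mem_cod_of_orderOf {H : Type*} [CommGroup H] [Finite H] (π : G →* H)
    (hπ : Function.Surjective π) {q : H} {m : ℕ} (hq : orderOf q = p ^ m) {i : ℕ} (hi : i ≤ m) :
    (p : ℂ) ^ i ∈ cod G := by
  obtain ⟨f, hf⟩ := exists_hom_index_ker H (q ^ p ^ (m - i))
  refine pow_mem_cod ((HasIrr.of_hom f).comap π hπ) ?_
  rw [index_comap_of_surjective _ hπ, hf, mul_one,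
    orderOf_pow_of_dvd (pow_ne_zero _ hp.out.ne_zero) (hq ▸ pow_dvd_pow p (Nat.sub_le m i)), hq,
    Nat.pow_div (Nat.sub_le m i) hp.out.pos, Nat.sub_sub_self hi]

theorem HasIrr.top {G : Type u} [Group G] : HasIrr G ⊤ 1 := by
  simpa using HasIrr.of_hom (1 : G →* ℂˣ)

/-- A `p`-group with cyclic center has a faithful irreducible representation. -/
theorem exists_faithful (hG : IsPGroup p G) [Nontrivial G] (hZ : IsCyclic (center G)) :
    ∃ d, HasIrr G ⊥ d := by
  have := hG.isNilpotent
  have hdvd : p ∣ Nat.card (center G) := ((hG.to_subgroup _).card_eq_or_dvd).resolve_left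
    fun h => Group.IsNilpotent.center_ne_bot (G := G) (eq_bot_of_card_eq _ h)
  obtain ⟨⟨z, hz⟩, hzo⟩ := exists_prime_orderOf_dvd_card' p hdvd
  rw [orderOf_mk] at hzo
  have hz1 : z ≠ 1 := by
    rintro rfl
    rw [orderOf_one] at hzo
    exact hp.out.one_lt.ne hzo
  -- A nontrivial kernel would contain the normal subgroup of order `p` generated by `z`, which this
  -- representation does not kill.
  obtain ⟨N, d, hN, hzN⟩ := HasIrr.exists_notMem hz1
  have hNn := hN.normal
  have hnorm : (zpowers z).Normal := by
    refine ⟨fun y hy g => ?_⟩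
    have : y ∈ center G := (zpowers_le.2 hz) hy
    rwa [mem_center_iff.1 this g, mul_inv_cancel_right]
  have hbot : N = ⊥ := by
    by_contra hne
    exact hzN (le_of_isCyclic_center hG (zpowers z) (by rw [Nat.card_zpowers, hzo]) N hne
      (mem_zpowers z))
  exact ⟨d, hbot ▸ hN⟩

theorem HasIrr.faithful_dim_eq {G : Type u} [Group G] {p : ℕ} (hnc : ¬ ∀ a b : G, a * b = b * a)
    (hdim : ∀ N d, HasIrr G N d → d = 1 ∨ d = p) {d : ℕ} (h : HasIrr G ⊥ d) : d = p := by
  refine (hdim _ _ h).resolve_left ?_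
  rintro rfl
  exact hnc (commutator_eq_bot_iff_comm.1 (le_bot_iff.1 h.commutator_le))

theorem nontrivial_of_not_comm {G : Type u} [Group G] (hnc : ¬ ∀ a b : G, a * b = b * a) : Nontrivial G := by
  by_contra h
  rw [not_nontrivial_iff_subsingleton] at h
  exact hnc fun a b => Subsingleton.elim _ _

/-- Upper bound for the codegrees of a noncyclic group of order `p ^ n` whose character degrees are
at most `p`. -/
theorem cod_subset (hG : Nat.card G = p ^ n) (hdim : ∀ N d, HasIrr G N d → d = 1 ∨ d = p)
    (hncyc : ¬ IsCyclic G) : cod G ⊆ {c : ℂ | ∃ i : ℕ, i ≤ n - 1 ∧ c = (p : ℂ) ^ i} := by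
  intro c hc
  rw [mem_cod_iff] at hc
  obtain ⟨N, d, hN, rfl⟩ := hc
  have hNn := hN.normal
  obtain ⟨m, hm, hmi⟩ := (Nat.dvd_prime_pow hp.out).1 (hG ▸ N.index_dvd_card)
  rcases hdim N d hN with rfl | hd
  · refine ⟨m, ?_, by rw [hmi]; simp⟩
    by_contra! hlt
    obtain rfl : m = n := by omega
    have hbot : N = ⊥ := by
      apply eq_bot_of_card_eq
      have := card_of_index_eq hG le_rfl hmi
      rwa [Nat.sub_self, pow_zero] at this
    subst hbot
    have := hN.isCyclic_quotient
    exact hncyc (isCyclic_of_surjective QuotientGroup.quotientBot.toMonoidHom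
      QuotientGroup.quotientBot.surjective)
  · subst hd
    have hm0 : m ≠ 0 := by
      rintro rfl
      rw [pow_zero, index_eq_one] at hmi
      exact hp.out.one_lt.ne' (hN.dim_eq_one_of_commutator_le (hmi ▸ le_top))
    refine ⟨m - 1, by omega, ?_⟩
    have hd0 : (d : ℂ) ≠ 0 := by exact_mod_cast hp.out.ne_zero
    rw [div_eq_iff hd0, ← pow_succ, Nat.sub_add_cancel (by omega : 1 ≤ m), hmi]
    push_cast
    rfl

theorem cod_eq (hG : Nat.card G = p ^ n) (hdim : ∀ N d, HasIrr G N d → d = 1 ∨ d = p)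
    (hncyc : ¬ IsCyclic G) (h : ∀ i ≤ n - 1, (p : ℂ) ^ i ∈ cod G) :
    cod G = {c : ℂ | ∃ i : ℕ, i ≤ n - 1 ∧ c = (p : ℂ) ^ i} := by
  refine Set.Subset.antisymm (cod_subset hG hdim hncyc) ?_
  rintro _ ⟨i, hi, rfl⟩
  exact h i hi

theorem cod_eq_of_mulEquiv_prod (hn : 2 ≤ n) (hG : Nat.card G = p ^ n)
    (e : G ≃* Multiplicative (ZMod (p ^ (n - 1))) × Multiplicative (ZMod p)) :
    cod G = {c : ℂ | ∃ i : ℕ, i ≤ n - 1 ∧ c = (p : ℂ) ^ i} := by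
  have hc : ∀ a b : G, a * b = b * a := fun a b => e.injective (by
    rw [map_mul, map_mul, mul_comm])
  have hp1 := hp.out.one_lt
  refine cod_eq hG (fun N d h => Or.inl (h.dim_eq_one_of_comm hc)) ?_ ?_
  · intro hcyc
    obtain ⟨x, hx⟩ := IsCyclic.exists_ofOrder_eq_natCard (α := G)
    have : x ^ p ^ (n - 1) = 1 := by
      apply e.injective
      rw [map_pow, map_one]
      ext
      · simp only [Prod.pow_fst, Prod.fst_one]
        have h := pow_card_eq_one' (x := (e x).1)
        rwa [Nat.card_eq_of_bijective _ Multiplicative.toAdd.bijective, Nat.card_zmod] at h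
      · simp only [Prod.pow_snd, Prod.snd_one]
        have h := pow_card_eq_one' (x := (e x).2)
        rw [Nat.card_eq_of_bijective _ Multiplicative.toAdd.bijective, Nat.card_zmod] at h
        have h2 : (e x).2 ^ p ^ (n - 1) = 1 := orderOf_dvd_iff_pow_eq_one.1
          ((orderOf_dvd_of_pow_eq_one h).trans (dvd_pow_self p (by omega)))
        rw [h2]
    have h1 := orderOf_dvd_of_pow_eq_one this
    rw [hx, hG] at h1
    have := (Nat.pow_dvd_pow_iff_le_right hp1).1 h1
    omega
  · intro i hi
    let : CommGroup G := { ‹Group G› with mul_comm := hc }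
    refine pow_mem_cod_of_orderOf (m := n - 1) (MonoidHom.id G) Function.surjective_id
      (q := e.symm (Multiplicative.ofAdd 1, 1)) ?_ hi
    have h := orderOf_injective e.symm.toMonoidHom e.symm.injective (Multiplicative.ofAdd 1, 1)
    refine h.trans ?_
    rw [Prod.orderOf_mk, orderOf_one, Nat.lcm_one_right, orderOf_ofAdd_eq_addOrderOf,
      ZMod.addOrderOf_one]

/-- The center lies in the cyclic subgroup generated by `x`, so a faithful representation exists, of
dimension `p` and codegree `p ^ (n - 1)`. The smaller codegrees come from the abelianization: $G'$
has exponent dividing `p`, so the image of `x` there keeps order at least `p ^ (n - 2)`. -/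
theorem cod_eq_of_orderOf (hn : 3 ≤ n) (hG : Nat.card G = p ^ n)
    (hnc : ¬ ∀ a b : G, a * b = b * a) (hclass : commutator G ≤ center G) {x : G}
    (hx : orderOf x = p ^ (n - 1)) :
    cod G = {c : ℂ | ∃ i : ℕ, i ≤ n - 1 ∧ c = (p : ℂ) ^ i} := by
  have hpG := IsPGroup.of_card hG
  have hp1 := hp.out.one_lt
  have hHi : (zpowers x).index = p := by
    have := (zpowers x).card_mul_index
    rw [Nat.card_zpowers, hx, hG] at this
    apply Nat.eq_of_mul_eq_mul_left (pow_pos hp.out.pos (n - 1))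
    rw [this, ← pow_succ, Nat.sub_add_cancel (by omega)]
  have hHn : (zpowers x).Normal := normal_of_index_eq_prime hpG _ hHi
  have hHc : ∀ a ∈ zpowers x, ∀ b ∈ zpowers x, a * b = b * a := by
    rintro _ ⟨i, rfl⟩ _ ⟨j, rfl⟩
    exact ((Commute.refl x).zpow_zpow i j).eq
  have hdim : ∀ N d, HasIrr G N d → d = 1 ∨ d = p := fun N d h => h.dim_eq hpG hHi hHc
  have hZ : IsCyclic (center G) :=
    isCyclic_of_injective (Subgroup.inclusion (center_le_of_index hHi hHc hnc))
      (Subgroup.inclusion_injective _)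
  refine cod_eq hG hdim (fun h => hnc (comm_of_isCyclic h)) fun i hi => ?_
  by_cases hin : i = n - 1
  · have := nontrivial_of_not_comm hnc
    obtain ⟨d, hd⟩ := exists_faithful hpG hZ
    have := hd.faithful_dim_eq hnc hdim
    subst this
    refine pow_mem_cod hd ?_
    rw [index_bot, hG, hin, ← pow_succ, Nat.sub_add_cancel (by omega)]
  · obtain ⟨j, -, hj⟩ : ∃ j ≤ n - 1, orderOf (Abelianization.of x) = p ^ j :=
      (Nat.dvd_prime_pow hp.out).1 (hx ▸ orderOf_map_dvd Abelianization.of x)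
    refine pow_mem_cod_of_orderOf Abelianization.of QuotientGroup.mk_surjective hj ?_
    have h1 : x ^ p ^ j ∈ commutator G := by
      rw [← Abelianization.ker_of, MonoidHom.mem_ker, map_pow, ← hj, pow_orderOf_eq_one]
    have h2 := pow_eq_one_of_mem_commutator hHi hHc hclass h1
    rw [← pow_mul, ← pow_succ] at h2
    have h3 := orderOf_dvd_of_pow_eq_one h2
    rw [hx] at h3
    have := (Nat.pow_dvd_pow_iff_le_right hp1).1 h3
    omega

end Codegree

/-! ### Codegrees of groups of maximal class -/

section MaximalClass

variable {p : ℕ} [hp : Fact p.Prime]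

theorem exists_card_quotient_center {G : Type u} [Group G] [Finite G] {n : ℕ}
    (hG : Nat.card G = p ^ n) (hnc : ¬ ∀ a b : G, a * b = b * a) :
    ∃ k, 0 < k ∧ k + 2 ≤ n ∧ Nat.card (center G) = p ^ k ∧
      Nat.card (G ⧸ center G) = p ^ (n - k) := by
  have hn : n ≠ 0 := by
    rintro rfl
    rw [pow_zero, Nat.card_eq_one_iff_unique] at hG
    have := hG.1
    exact hnc fun a b => Subsingleton.elim _ _
  obtain ⟨k, hk0, hk⟩ := exists_center_card hG hn
  have hkn := center_card_le hG hnc hk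
  refine ⟨k, hk0, hkn, hk, ?_⟩
  have h := (center G).card_mul_index
  rw [hk, hG, index_eq_card] at h
  apply Nat.eq_of_mul_eq_mul_left (pow_pos hp.out.pos k)
  rw [h, ← pow_add, Nat.add_sub_cancel' (by omega : k ≤ n)]

theorem nilpotencyClass_le (n : ℕ) (hn : 2 ≤ n) : ∀ (G : Type u) [Group G] [Finite G],
    Nat.card G = p ^ n → Group.nilpotencyClass G ≤ n - 1 := by
  induction n using Nat.strong_induction_on with
  | _ n ih =>
    intro G _ _ hG
    by_cases hnc : ∀ a b : G, a * b = b * a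
    · exact (nilpotencyClass_le_one_of_comm hnc).trans (by omega)
    · obtain ⟨k, hk0, hkn, -, hq⟩ := exists_card_quotient_center hG hnc
      have := nontrivial_of_not_comm hnc
      rw [nilpotencyClass_eq_succ (IsPGroup.of_card hG)]
      have := ih (n - k) (by omega) (by omega) (G ⧸ center G) hq
      omega

/-- If $|Z(G)|=p^k$, the class is at most $(n-k-1)+1$, which forces $k=1$. The quotient by the
center again has maximal class, which drives the inductions below. -/
theorem center_of_maximalClass {n : ℕ} (hn : 3 ≤ n) {G : Type u} [Group G] [Finite G]
    (hG : Nat.card G = p ^ n) (hclass : Group.nilpotencyClass G = n - 1) :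
    (¬ ∀ a b : G, a * b = b * a) ∧ Nat.card (center G) = p ∧
      Nat.card (G ⧸ center G) = p ^ (n - 1) ∧
      Group.nilpotencyClass (G ⧸ center G) = n - 1 - 1 := by
  have hnc : ¬ ∀ a b : G, a * b = b * a := fun hc => by
    have := nilpotencyClass_le_one_of_comm hc
    omega
  obtain ⟨k, hk0, hkn, hk, hq⟩ := exists_card_quotient_center hG hnc
  have := nontrivial_of_not_comm hnc
  have h1 := nilpotencyClass_eq_succ (IsPGroup.of_card hG)
  have h2 := nilpotencyClass_le (n - k) (by omega) (G ⧸ center G) hq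
  obtain rfl : k = 1 := by omega
  exact ⟨hnc, by rw [hk, pow_one], hq, by omega⟩

theorem exists_faithful_of_maximalClass {n : ℕ} (hn : 3 ≤ n) {G : Type u} [Group G] [Finite G]
    (hG : Nat.card G = p ^ n) (hclass : Group.nilpotencyClass G = n - 1) :
    ∃ d, HasIrr G ⊥ d := by
  obtain ⟨hnc, hZ, -, -⟩ := center_of_maximalClass hn hG hclass
  have := nontrivial_of_not_comm hnc
  exact exists_faithful (IsPGroup.of_card hG) (isCyclic_of_prime_card hZ)

/-- Inflation through central quotients reduces to order $p^3$, where a subgroup of order $p^2$ is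
commutative of index $p$. This identifies the second degree as $p$ when there are only two. -/
theorem exists_dim_prime_of_maximalClass (n : ℕ) (hn : 3 ≤ n) :
    ∀ (G : Type u) [Group G] [Finite G], Nat.card G = p ^ n →
    Group.nilpotencyClass G = n - 1 → ∃ N, HasIrr G N p := by
  induction n, hn using Nat.le_induction with
  | base =>
    intro G _ _ hG hclass
    obtain ⟨hnc, -⟩ := center_of_maximalClass le_rfl hG hclass
    obtain ⟨d, hd⟩ := exists_faithful_of_maximalClass le_rfl hG hclass
    obtain ⟨A, hA⟩ := Sylow.exists_subgroup_card_pow_prime (G := G) p (n := 2)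
      (hG ▸ pow_dvd_pow p (by norm_num))
    have hAi : A.index = p := by
      have := A.card_mul_index
      rw [hA, hG] at this
      apply Nat.eq_of_mul_eq_mul_left (pow_pos hp.out.pos 2)
      rw [this]; ring
    have hAc : ∀ a ∈ A, ∀ b ∈ A, a * b = b * a := fun a ha b hb =>
      congrArg Subtype.val
        ((IsPGroup.isMulCommutative_of_card_eq_prime_sq hA).is_comm.comm ⟨a, ha⟩ ⟨b, hb⟩)
    have := hd.faithful_dim_eq hnc
      fun N e h => h.dim_eq (IsPGroup.of_card hG) hAi hAc
    subst this
    exact ⟨⊥, hd⟩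
  | succ n hn ih =>
    intro G _ _ hG hclass
    obtain ⟨-, -, hq, hqc⟩ := center_of_maximalClass (by omega) hG hclass
    obtain ⟨N, hN⟩ := ih (G ⧸ center G) hq hqc
    exact ⟨_, hN.comap _ (QuotientGroup.mk'_surjective _)⟩

/-- A faithful representation of `G` realises the top exponent, and those of the successive central
quotients realise the lower ones down to `2`. -/
theorem exists_index_of_maximalClass (n : ℕ) (hn : 3 ≤ n) :
    ∀ (G : Type u) [Group G] [Finite G], Nat.card G = p ^ n →
    Group.nilpotencyClass G = n - 1 → (∀ N d, HasIrr G N d → d = 1 ∨ d = p) →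
    ∀ i, 2 ≤ i → i + 1 ≤ n → ∃ N, HasIrr G N p ∧ N.index = p ^ i * p := by
  induction n, hn using Nat.le_induction with
  | base =>
    intro G _ _ hG hclass hdim i hi hin
    obtain ⟨hnc, -⟩ := center_of_maximalClass le_rfl hG hclass
    obtain ⟨d, hd⟩ := exists_faithful_of_maximalClass le_rfl hG hclass
    have := hd.faithful_dim_eq hnc hdim
    subst this
    refine ⟨⊥, hd, ?_⟩
    rw [index_bot, hG, ← pow_succ]
    congr 1
    omega
  | succ n hn ih =>
    intro G _ _ hG hclass hdim i hi hin
    obtain ⟨hnc, -, hq, hqc⟩ := center_of_maximalClass (by omega) hG hclass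
    by_cases hi' : i = n
    · obtain ⟨d, hd⟩ := exists_faithful_of_maximalClass (by omega) hG hclass
      have := hd.faithful_dim_eq hnc hdim
      subst this
      exact ⟨⊥, hd, by rw [index_bot, hG, hi', ← pow_succ]⟩
    · obtain ⟨N, hN, hNi⟩ := ih (G ⧸ center G) hq hqc
        (fun N d h => hdim _ _ (h.comap _ (QuotientGroup.mk'_surjective _))) i hi (by omega)
      refine ⟨_, hN.comap _ (QuotientGroup.mk'_surjective _), ?_⟩
      rw [index_comap_of_surjective _ (QuotientGroup.mk'_surjective _), hNi]

theorem cod_eq_of_maximalClass {n : ℕ} (hn : 2 ≤ n) {G : Type u} [Group G] [Finite G]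
    (hG : Nat.card G = p ^ n) (hclass : Group.nilpotencyClass G = n - 1)
    (hcd : (cd G).ncard = 2) :
    cod G = {c : ℂ | ∃ i : ℕ, i ≤ n - 1 ∧ c = (p : ℂ) ^ i} := by
  have hnc : ¬ ∀ a b : G, a * b = b * a := by
    intro hc
    have : cd G ⊆ {1} := by
      intro c h
      rw [mem_cd_iff] at h
      obtain ⟨N, d, h, rfl⟩ := h
      rw [h.dim_eq_one_of_comm hc]
      simp
    have := Set.ncard_le_ncard this
    rw [hcd, Set.ncard_singleton] at this
    omega
  have hn3 : 3 ≤ n := by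
    by_contra! hlt
    obtain rfl : n = 2 := by omega
    exact hnc (IsPGroup.isMulCommutative_of_card_eq_prime_sq hG).is_comm.comm
  obtain ⟨N, hN⟩ := exists_dim_prime_of_maximalClass n hn3 G hG hclass
  have hdim : ∀ N d, HasIrr G N d → d = 1 ∨ d = p := by
    intro M d hM
    by_contra! hd
    have hsub : ({1, (p : ℂ), (d : ℂ)} : Set ℂ) ⊆ cd G := by
      rintro c (rfl | rfl | rfl)
      · exact (mem_cd_iff _).2 ⟨_, _, HasIrr.top, by simp⟩
      · exact (mem_cd_iff _).2 ⟨_, _, hN, rfl⟩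
      · exact (mem_cd_iff _).2 ⟨_, _, hM, rfl⟩
    -- `Set.ncard` of an infinite set is `0`, so the value `2` includes finiteness of the set of
    -- degrees.
    have h1 := Set.ncard_le_ncard hsub (Set.finite_of_ncard_ne_zero (by omega))
    have h2 : (1 : ℂ) ≠ p := by exact_mod_cast hp.out.one_lt.ne
    have h3 : (1 : ℂ) ≠ d := by exact_mod_cast hd.1.symm
    have h4 : (p : ℂ) ≠ d := by exact_mod_cast hd.2.symm
    rw [hcd, Set.ncard_eq_three.2 ⟨_, _, _, h2, h3, h4, rfl⟩] at h1
    omega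
  have hpG := IsPGroup.of_card hG
  refine cod_eq hG hdim (fun h => hnc (comm_of_isCyclic h)) fun i hi => ?_
  by_cases hi2 : 2 ≤ i
  · obtain ⟨N, hN, hNi⟩ := exists_index_of_maximalClass n hn3 G hG hclass hdim i hi2 (by omega)
    exact pow_mem_cod hN hNi
  -- The codegrees `1` and `p` come from an element of order `p` in the nontrivial abelianization.
  · have := hpG.isNilpotent
    have hab : IsPGroup p (Abelianization G) := hpG.to_quotient _
    have hdvd : p ∣ Nat.card (Abelianization G) := hab.card_eq_or_dvd.resolve_left fun h => by
      have := (Nat.card_eq_one_iff_unique.1 h).1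
      exact hnc (comm_of_isCyclic_abelianization inferInstance)
    obtain ⟨q, hq⟩ := exists_prime_orderOf_dvd_card' p hdvd
    exact pow_mem_cod_of_orderOf (m := 1) Abelianization.of QuotientGroup.mk_surjective
      (by rw [hq, pow_one]) (by omega)

end MaximalClass

/-! ### The classification -/

section Main

variable {G : Type u} [Group G] [Finite G] {p n : ℕ} [hp : Fact p.Prime]

theorem cod_eq_of_mulEquiv_semidirectProduct (hn : 4 ≤ n) (hG : Nat.card G = p ^ n)
    {φ : Multiplicative (ZMod p) →* MulAut (Multiplicative (ZMod (p ^ (n - 1))))}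
    (e : G ≃* Multiplicative (ZMod (p ^ (n - 1))) ⋊[φ] Multiplicative (ZMod p))
    (hclass : Group.nilpotencyClass G = 2) :
    cod G = {c : ℂ | ∃ i : ℕ, i ≤ n - 1 ∧ c = (p : ℂ) ^ i} := by
  have hnc : ¬ ∀ a b : G, a * b = b * a := fun hc => by
    have := nilpotencyClass_le_one_of_comm hc
    omega
  refine cod_eq_of_orderOf (by omega) hG hnc
    ((commutator_le_center_iff (IsPGroup.of_card hG)).2 hclass.le)
    (x := e.symm (SemidirectProduct.inl (Multiplicative.ofAdd 1))) ?_
  refine (orderOf_injective e.symm.toMonoidHom e.symm.injective _).trans ?_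
  rw [orderOf_injective _ SemidirectProduct.inl_injective, orderOf_ofAdd_eq_addOrderOf,
    ZMod.addOrderOf_one]

theorem cd_ncard_of_faithful (hpG : IsPGroup p G) (hf : HasIrr G ⊥ p) : (cd G).ncard = 2 := by
  obtain ⟨A, -, hA, hAc⟩ := hf.exists_comm_subgroup hpG
  have h2 : (1 : ℂ) ≠ p := by exact_mod_cast hp.out.one_lt.ne
  rw [Set.ncard_eq_two]
  refine ⟨1, p, h2, Set.Subset.antisymm ?_ ?_⟩
  · intro c hc
    obtain ⟨N, d, h, rfl⟩ := (mem_cd_iff c).1 hc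
    rcases h.dim_eq hpG hA hAc with rfl | rfl
    · simp
    · simp
  · rintro c (rfl | rfl)
    · exact (mem_cd_iff _).2 ⟨_, _, HasIrr.top, by simp⟩
    · exact (mem_cd_iff _).2 ⟨_, _, hf, rfl⟩

theorem classification_of_cod_eq (hn : 2 ≤ n) (hG : Nat.card G = p ^ n)
    (h : cod G = {c : ℂ | ∃ i : ℕ, i ≤ n - 1 ∧ c = (p : ℂ) ^ i}) :
    (Nonempty (G ≃* Multiplicative (ZMod (p ^ (n - 1))) × Multiplicative (ZMod p))) ∨
    ((∃ φ : Multiplicative (ZMod p) →* MulAut (Multiplicative (ZMod (p ^ (n - 1)))),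
        Nonempty (G ≃* Multiplicative (ZMod (p ^ (n - 1))) ⋊[φ] Multiplicative (ZMod p))) ∧
      Group.nilpotencyClass G = 2 ∧ 4 ≤ n) ∨
    (HasMaximalClass p G ∧ (cd G).ncard = 2) := by
  have hpG := IsPGroup.of_card hG
  have hp1 := hp.out.one_lt
  have hcod : ∀ i, i ≤ n - 1 → ∃ N d, HasIrr G N d ∧ N.index = p ^ i * d := fun i hi =>
    exists_of_pow_mem_cod (by rw [h]; exact ⟨i, hi, rfl⟩)
  obtain ⟨N, d, hN, hNi⟩ := hcod (n - 1) le_rfl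
  have hNn := hN.normal
  by_cases hd1 : d = 1
  · subst hd1
    left
    rw [mul_one] at hNi
    have hNc : Nat.card N = p := by
      have := card_of_index_eq hG (by omega) hNi
      rwa [show n - (n - 1) = 1 by omega, pow_one] at this
    have hc := comm_of_isCyclic_quotient (le_center_of_card_eq_prime hpG N hNc)
      hN.isCyclic_quotient
    refine nonempty_mulEquiv_prod_of_isCyclic_quotient (by omega) hG hc ?_ N hNi
      hN.isCyclic_quotient
    intro hcyc
    obtain ⟨x, hx⟩ := IsCyclic.exists_ofOrder_eq_natCard (α := G)
    let : CommGroup G := { ‹Group G› with mul_comm := hc }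
    have hmem := pow_mem_cod_of_orderOf (m := n) (MonoidHom.id G) Function.surjective_id
      (q := x) (hx.trans hG) le_rfl
    rw [h] at hmem
    obtain ⟨i, hi, hpi⟩ := hmem
    have := Nat.pow_right_injective hp.out.two_le (by exact_mod_cast hpi : p ^ n = p ^ i)
    omega
  right
  -- The index `p ^ (n - 1) * d` is a power of `p` dividing `p ^ n` and exceeds `p ^ (n - 1)`, so it
  -- equals `p ^ n`.
  have hdp : d = p ∧ N = ⊥ := by
    obtain ⟨m, hm, hmi⟩ := (Nat.dvd_prime_pow hp.out).1 (hG ▸ N.index_dvd_card)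
    rw [hNi] at hmi
    have hlt : p ^ (n - 1) < p ^ m := by
      rw [← hmi]
      have := hN.pos
      exact lt_mul_of_one_lt_right (pow_pos hp.out.pos _) (by omega)
    have hmn : m = n := by
      have := (Nat.pow_lt_pow_iff_right hp1).1 hlt
      omega
    subst hmn
    constructor
    · apply Nat.eq_of_mul_eq_mul_left (pow_pos hp.out.pos (m - 1))
      rw [hmi, ← pow_succ, Nat.sub_add_cancel (by omega)]
    · apply eq_bot_of_card_eq
      have := card_of_index_eq hG le_rfl (hNi.trans hmi)
      rwa [Nat.sub_self, pow_zero] at this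
  obtain ⟨rfl, rfl⟩ := hdp
  have hnc := hN.not_comm_of_prime
  have hn3 : 3 ≤ n := by
    by_contra! hlt
    obtain rfl : n = 2 := by omega
    exact hnc (IsPGroup.isMulCommutative_of_card_eq_prime_sq hG).is_comm.comm
  rcases maximalClass_or_card_commutator n hn3 G hG hN (fun i _ hi => hcod i (by omega)) with
    ⟨hclass, -⟩ | ⟨hn4, hcard, M, hMn, hMc, hMi⟩
  · exact Or.inr ⟨⟨n, hn, hG, hclass⟩, cd_ncard_of_faithful hpG hN⟩
  · left
    obtain ⟨x, hx, hsub⟩ := exists_orderOf_eq hn4 hG hnc hN.isCyclic_center hcard M hMi hMc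
    exact ⟨exists_mulEquiv_semidirectProduct_of_orderOf hn4 hG hnc hcard hx hsub,
      nilpotencyClass_eq_two hpG hnc (le_center_of_card_eq_prime hpG _ hcard), hn4⟩

end Main

end FiniteGroupCharacters

theorem theoremA {G : Type*} [Group G] [Finite G] (p n : ℕ) (hp : p.Prime) (hn : 2 ≤ n)
    (hG : Nat.card G = p ^ n) :
    (FiniteGroupCharacters.cod G = {c : ℂ | ∃ i : ℕ, i ≤ n - 1 ∧ c = (p : ℂ) ^ i} ↔
      (Nonempty (G ≃* Multiplicative (ZMod (p ^ (n - 1))) × Multiplicative (ZMod p))) ∨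
      ((∃ φ : Multiplicative (ZMod p) →* MulAut (Multiplicative (ZMod (p ^ (n - 1)))),
          Nonempty (G ≃* Multiplicative (ZMod (p ^ (n - 1))) ⋊[φ] Multiplicative (ZMod p))) ∧
        Group.nilpotencyClass G = 2 ∧ 4 ≤ n) ∨
      (FiniteGroupCharacters.HasMaximalClass p G ∧
        (FiniteGroupCharacters.cd G).ncard = 2)) ∧
    (FiniteGroupCharacters.cod G = {c : ℂ | ∃ i : ℕ, i ≤ n - 1 ∧ c = (p : ℂ) ^ i} →
      Group.nilpotencyClass G ≤ 2 ∨ FiniteGroupCharacters.HasMaximalClass p G) := by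
  have := Fact.mk hp
  refine ⟨⟨FiniteGroupCharacters.classification_of_cod_eq hn hG, ?_⟩, fun h => ?_⟩
  · rintro (⟨⟨e⟩⟩ | ⟨⟨φ, ⟨e⟩⟩, hclass, hn4⟩ | ⟨⟨m, hm, hGm, hclass⟩, hcd⟩)
    · exact FiniteGroupCharacters.cod_eq_of_mulEquiv_prod hn hG e
    · exact FiniteGroupCharacters.cod_eq_of_mulEquiv_semidirectProduct hn4 hG e hclass
    -- `HasMaximalClass` carries its own exponent, which the order of `G` identifies with `n`.
    · obtain rfl : n = m := Nat.pow_right_injective hp.two_le (hG.symm.trans hGm)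
      exact FiniteGroupCharacters.cod_eq_of_maximalClass hn hG hclass hcd
  · rcases FiniteGroupCharacters.classification_of_cod_eq hn hG h with
      ⟨⟨e⟩⟩ | ⟨-, hclass, -⟩ | ⟨hmax, -⟩
    · refine Or.inl ((FiniteGroupCharacters.nilpotencyClass_le_one_of_comm fun a b =>
        e.injective ?_).trans one_le_two)
      rw [map_mul, map_mul, mul_comm]
    · exact Or.inl hclass.le
    · exact Or.inr hmax
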